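/- Let $A=\begin{pmatrix}0&-1\\1&0\end{pmatrix}$ and $B=\begin{pmatrix}1&-1\\1&0\end{pmatrix}$ be the standard generators, of orders two and three, of $PSL(2,\mathbb Z)\cong\mathbb Z_2*\mathbb Z_3$. A reciprocal geodesic on the modular surface $\mathbb H/PSL(2,\mathbb Z)$ (powers included) is identified with the conjugacy class in $PSL(2,\mathbb Z)$ of a hyperbolic element whose axis passes through a point of $\mathbb H$ fixed by an element of order two. Its word length $|\gamma|$ is the minimal word length, with respect to $A,B,B^{-1}$, of the elements of that conjugacy class. The conjugacy class of a hyperbolic element contains an element in normal form $AB^{\epsilon_1}\cdots AB^{\epsilon_k}$ with $\epsilon_i=\pm1$ and $\epsilon_1\ne\epsilon_k$, unique up to a cyclic shift of the signs; the geodesic has exactly $m$ cusp excursions of depth greater than $D$ if exactly $m$ of the maximal runs of consecutive equal signs in $(\epsilon_1,\dots,\epsilon_k)$ have length greater than $D$. Let $\mathcal E_2^D$ be the set of reciprocal geodesics with exactly two cusp excursions of depth greater than $D$. **Theorem.** Let $D\ge 2$ be an integer. The polynomial $z^D-z^{D-1}-\cdots-z-1$ has a unique positive root $\alpha_D$; for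 every $t$ the set $\{\gamma\in\mathcal E_2^D:|\gamma|=4t\}$ is finite; and $$\frac{\bigl|\{\gamma\in\mathcal E_2^D:|\gamma|=4t\}\bigr|}{t\,\alpha_D^{\,t}}\;\longrightarrow\;\frac{d_D^2}{\alpha_D^{D}(\alpha_D-1)}\qquad(t\to\infty),\qquad\text{where } d_D=\frac{\alpha_D-1}{2+(D+1)(\alpha_D-2)} .$$ -/

import Mathlib

open Filter Topology

namespace ReciprocalGeodesics

/-- The modular group `PSL(2, ℤ)`. -/
abbrev PSL2Z : Type := Matrix.ProjectiveSpecialLinearGroup (Fin 2) ℤ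

/-- The projection `SL(2, ℤ) → PSL(2, ℤ)`. -/
def proj : Matrix.SpecialLinearGroup (Fin 2) ℤ →* PSL2Z :=
  QuotientGroup.mk' _

/-- The matrix of the generator `A`. -/
def matA : Matrix.SpecialLinearGroup (Fin 2) ℤ :=
  ⟨!![0, -1; 1, 0], by simp [Matrix.det_fin_two]⟩

/-- The matrix of the generator `B`. -/
def matB : Matrix.SpecialLinearGroup (Fin 2) ℤ :=
  ⟨!![1, -1; 1, 0], by simp [Matrix.det_fin_two]⟩

/-- The generator `A` of order two of the modular group. -/
def A : PSL2Z := proj matA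

/-- The generator `B` of order three of the modular group. -/
def B : PSL2Z := proj matB

/-- The word length of an element of `PSL(2, ℤ)` with respect to `A`, `B`, `B⁻¹`. -/
noncomputable def elementLength (g : PSL2Z) : ℕ :=
  sInf {n | ∃ w : List PSL2Z, (∀ s ∈ w, s = A ∨ s = B ∨ s = B⁻¹) ∧ w.prod = g ∧ w.length = n}

/-- The word length of a conjugacy class: the minimal word length of its elements. -/
noncomputable def wordLength (c : ConjClasses PSL2Z) : ℕ :=
  sInf {n | ∃ g : PSL2Z, ConjClasses.mk g = c ∧ elementLength g = n}

/-- A matrix in `SL(2, ℤ)` is hyperbolic if its trace has absolute value greater than two. -/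
def IsHyperbolic (h : Matrix.SpecialLinearGroup (Fin 2) ℤ) : Prop :=
  2 < |Matrix.trace (h : Matrix (Fin 2) (Fin 2) ℤ)|

/-- The axis in the hyperbolic plane of a hyperbolic isometry: the geodesic along which it
translates, which is the set of the points that it displaces least. -/
def axis (h : Matrix.SpecialLinearGroup (Fin 2) ℤ) : Set UpperHalfPlane :=
  {z | ∀ w : UpperHalfPlane, dist z (h • z) ≤ dist w (h • w)}

/-- The point `z` is fixed by an element of order two of the modular group. -/
def IsOrderTwoPoint (z : UpperHalfPlane) : Prop :=
  ∃ k : Matrix.SpecialLinearGroup (Fin 2) ℤ, orderOf (proj k) = 2 ∧ k • z = z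

/-- A reciprocal geodesic on the modular surface, given by its lift: the conjugacy class in
`PSL(2, ℤ)` of a hyperbolic element whose axis passes through an order two fixed point.
Powers are allowed. -/
def IsReciprocal (c : ConjClasses PSL2Z) : Prop :=
  ∃ h : Matrix.SpecialLinearGroup (Fin 2) ℤ,
    IsHyperbolic h ∧ ConjClasses.mk (proj h) = c ∧ ∃ z ∈ axis h, IsOrderTwoPoint z

/-- The element `A B^ε₁ A B^ε₂ ⋯ A B^εₖ` of the modular group, where each `εᵢ` is a sign. -/
def signWord (ε : List ℤˣ) : PSL2Z :=
  (ε.map fun e => A * B ^ (e : ℤ)).prod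

/-- The run sequence of a tuple of signs: the lengths, in order, of its maximal blocks of
consecutive equal signs. -/
def runs (ε : List ℤˣ) : List ℕ :=
  (ε.splitBy (· == ·)).map List.length

/-- The signs `ε₁, …, εₖ` form a normal form of the class `c`: `ε₁ ≠ εₖ`, and
`A B^ε₁ ⋯ A B^εₖ` belongs to `c`. -/
def IsNormalForm (ε : List ℤˣ) (c : ConjClasses PSL2Z) : Prop :=
  ε.head? ≠ ε.getLast? ∧ ConjClasses.mk (signWord ε) = c

/-- The closed geodesic `c` has exactly `k` cusp excursions of depth greater than `D`: the run
sequence of its normal form (unique up to a cyclic shift) has exactly `k` parts greater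
than `D`. -/
def HasExcursions (D k : ℕ) (c : ConjClasses PSL2Z) : Prop :=
  ∃ ε : List ℤˣ, IsNormalForm ε c ∧ (runs ε).countP (fun r => D < r) = k

/-- The set of the reciprocal geodesics with exactly `k` cusp excursions of depth greater
than `D`. -/
def excursionSet (D k : ℕ) : Set (ConjClasses PSL2Z) :=
  {c | IsReciprocal c ∧ HasExcursions D k c}

/-- `α` is a positive root of the polynomial `z ^ D - z ^ (D - 1) - ⋯ - 1`. -/
def IsPosRoot (D : ℕ) (α : ℝ) : Prop :=
  0 < α ∧ α ^ D - ∑ i ∈ Finset.range D, α ^ i = 0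

/-- The constant `d_D`, as a function of `D` and of the root `α = α_D`. -/
noncomputable def dConst (D : ℕ) (α : ℝ) : ℝ :=
  (α - 1) / (2 + ((D : ℝ) + 1) * (α - 2))

end ReciprocalGeodesics

/-! If the axis of `h` passes through the fixed point of an involution `k`, then `h * k` has trace
zero, so `h` is a product of two involutions. All involutions are conjugate to `A`, hence `h` is
conjugate to some `g * A * g⁻¹ * A`, and the normal form of `g` turns this into the sign word of `l
++ l*`, where `l*` is `l` reversed and negated (`isReciprocal_iff`). Conjugate sign words are cyclic
shifts of each other (`isRotated_of_isConj_signWord`), and the length of a class is twice its number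
of signs (`wordLength_mk_signWord`). So length `4 * t` means that `l` has `t` signs, and two
excursions mean that `l` has one long run, because no run crosses a junction between `l` and `l*`.

The only sequences giving the same class as `l` are `l` and `l*`
(`eq_or_eq_negReverse_of_isRotated`), and these differ because an antipalindrome has an even number
of long runs. A sign sequence is in turn a first sign and a composition of `t` into run lengths. The
two factors of two cancel: the classes are as many as the compositions of `t` with exactly one part
greater than `D` (`ncard_excursionSet`).

With `P` and `Q` the series of the short and of the long parts, these compositions have generating
function `Q / (1 - P) ^ 2`. The equation for `α` says that the weights `α⁻¹ ^ k`, `1 ≤ k ≤ D`, form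
a probability distribution; the scaled coefficients of `1 / (1 - P)` are its renewal sequence and
tend to the inverse of its mean, which is `dConst` (`tendsto_scaledCount`). The square then has
coefficients of linear growth with slope `dConst ^ 2`, and convolution with `Q`, whose scaled
coefficients have sum `1 / (α ^ D * (α - 1))`, gives the limit. -/

namespace ReciprocalGeodesics

/-! ### The free semigroup on `A * B` and `A * B⁻¹` -/

lemma proj_eq_iff (X Y : Matrix.SpecialLinearGroup (Fin 2) ℤ) :
    proj X = proj Y ↔ X = Y ∨ X = -Y := by
  have key : proj X = proj Y ↔ X⁻¹ * Y ∈ Subgroup.center (Matrix.SpecialLinearGroup (Fin 2) ℤ) :=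
    QuotientGroup.eq
  rw [key, Matrix.SpecialLinearGroup.mem_center_iff]
  constructor
  · rintro ⟨r, hr, h⟩
    have hr' : r = 1 ∨ r = -1 := by
      simpa using hr
    rcases hr' with rfl | rfl
    · left
      have : X⁻¹ * Y = 1 := by
        apply Subtype.ext; rw [← h]; simp
      rw [inv_mul_eq_one] at this; exact this
    · right
      have : X⁻¹ * Y = -1 := by
        apply Subtype.ext; rw [← h]; ext i j; fin_cases i <;> fin_cases j <;> simp
      rw [inv_mul_eq_iff_eq_mul] at this; rw [this]; simp
  · rintro (h | h)
    · exact ⟨1, by simp, by rw [h]; simp⟩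
    · refine ⟨-1, by simp, ?_⟩
      rw [h]
      have : (-Y)⁻¹ * Y = -1 := by rw [inv_mul_eq_iff_eq_mul]; simp
      rw [this]; ext i j; fin_cases i <;> fin_cases j <;> simp

lemma proj_surjective : Function.Surjective proj := QuotientGroup.mk'_surjective _

@[simp] lemma coe_matA : (matA : Matrix (Fin 2) (Fin 2) ℤ) = !![0, -1; 1, 0] := rfl

@[simp] lemma coe_matB : (matB : Matrix (Fin 2) (Fin 2) ℤ) = !![1, -1; 1, 0] := rfl

@[simp] lemma coe_matB_inv :
    ((matB⁻¹ : Matrix.SpecialLinearGroup (Fin 2) ℤ) : Matrix (Fin 2) (Fin 2) ℤ) =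
      !![0, 1; -1, 1] := by
  rw [Matrix.SpecialLinearGroup.SL2_inv_expl]
  ext i j
  fin_cases i <;> fin_cases j <;> simp

lemma A_mul_A : A * A = 1 := by
  rw [A, ← map_mul, ← map_one proj, proj_eq_iff]
  right
  ext i j
  fin_cases i <;> fin_cases j <;> simp [Matrix.SpecialLinearGroup.coe_mul]

lemma A_mul_A_mul (g : PSL2Z) : A * (A * g) = g := by
  rw [← mul_assoc, A_mul_A, one_mul]

lemma A_inv : A⁻¹ = A := inv_eq_of_mul_eq_one_left A_mul_A

lemma B_mul_B : B * B = B⁻¹ := by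
  rw [eq_inv_iff_mul_eq_one, B, ← map_mul, ← map_mul, ← map_one proj, proj_eq_iff]
  right
  ext i j
  fin_cases i <;> fin_cases j <;> simp [Matrix.SpecialLinearGroup.coe_mul]

lemma B_inv_mul_B_inv : B⁻¹ * B⁻¹ = B := by
  rw [← mul_inv_rev, B_mul_B, inv_inv]

/-- A matrix in `SL(2, ℤ)` representing `A * B ^ e`. -/
def signMat (e : ℤˣ) : Matrix.SpecialLinearGroup (Fin 2) ℤ :=
  if e = 1 then ⟨!![1, 0; -1, 1], by simp [Matrix.det_fin_two]⟩
  else ⟨!![1, -1; 0, 1], by simp [Matrix.det_fin_two]⟩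

/-- A matrix in `SL(2, ℤ)` representing `signWord ε`. -/
def wordMat (ε : List ℤˣ) : Matrix.SpecialLinearGroup (Fin 2) ℤ :=
  (ε.map signMat).prod

@[simp] lemma coe_signMat_one :
    (signMat 1 : Matrix (Fin 2) (Fin 2) ℤ) = !![1, 0; -1, 1] := by
  simp [signMat]

@[simp] lemma coe_signMat_neg_one :
    (signMat (-1) : Matrix (Fin 2) (Fin 2) ℤ) = !![1, -1; 0, 1] := by
  have : (-1 : ℤˣ) ≠ 1 := by decide
  simp [signMat, this]

lemma proj_signMat (e : ℤˣ) : proj (signMat e) = A * B ^ (e : ℤ) := by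
  rcases Int.units_eq_one_or e with rfl | rfl
  · simp only [Units.val_one, zpow_one]
    rw [A, B, ← map_mul, proj_eq_iff]
    right
    ext i j
    fin_cases i <;> fin_cases j <;> simp [Matrix.SpecialLinearGroup.coe_mul]
  · simp only [Units.val_neg, Units.val_one, zpow_neg, zpow_one]
    rw [A, B, ← map_inv, ← map_mul, proj_eq_iff]
    left
    ext i j
    fin_cases i <;> fin_cases j <;> simp [Matrix.SpecialLinearGroup.coe_mul]

/-- The body of `signWord` elaborates with the whole list coerced to `List ℤ` through the list
monad; here the coercion is moved to each sign. -/
lemma signWord_eq_prod (ε : List ℤˣ) :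
    signWord ε = (ε.map fun e : ℤˣ => A * B ^ (e : ℤ)).prod := by
  have h : (do let a ← ε; pure (a : ℤ) : List ℤ) = ε.map fun e : ℤˣ => (e : ℤ) := by
    induction ε <;> simp_all
  rw [signWord, h, List.map_map]
  rfl

lemma proj_wordMat (ε : List ℤˣ) : proj (wordMat ε) = signWord ε := by
  rw [wordMat, map_list_prod, signWord_eq_prod, List.map_map]
  exact congrArg List.prod (List.map_congr_left fun e _ => proj_signMat e)

@[simp] lemma signWord_nil : signWord [] = 1 := rfl

lemma signWord_cons (e : ℤˣ) (l : List ℤˣ) :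
    signWord (e :: l) = A * B ^ (e : ℤ) * signWord l := by
  simp [signWord_eq_prod]

lemma signWord_append (l m : List ℤˣ) : signWord (l ++ m) = signWord l * signWord m := by
  simp [signWord_eq_prod]

lemma wordMat_cons_one (l : List ℤˣ) : (wordMat (1 :: l) : Matrix (Fin 2) (Fin 2) ℤ) =
    !![wordMat l 0 0, wordMat l 0 1; wordMat l 1 0 - wordMat l 0 0,
      wordMat l 1 1 - wordMat l 0 1] := by
  rw [wordMat, List.map_cons, List.prod_cons, ← wordMat, Matrix.SpecialLinearGroup.coe_mul]
  ext i j
  fin_cases i <;> fin_cases j <;> simp [Matrix.mul_apply, Fin.sum_univ_two] <;> ring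

lemma wordMat_cons_neg_one (l : List ℤˣ) :
    (wordMat (-1 :: l) : Matrix (Fin 2) (Fin 2) ℤ) =
    !![wordMat l 0 0 - wordMat l 1 0, wordMat l 0 1 - wordMat l 1 1; wordMat l 1 0,
      wordMat l 1 1] := by
  rw [wordMat, List.map_cons, List.prod_cons, ← wordMat, Matrix.SpecialLinearGroup.coe_mul]
  ext i j
  fin_cases i <;> fin_cases j <;> simp [Matrix.mul_apply, Fin.sum_univ_two] <;> ring

lemma wordMat_nil : wordMat [] = 1 := rfl

/-- Multiplying by a sign matrix on the left subtracts one row from the other, which preserves this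
sign pattern. The pattern also tells a word matrix from its negative, so sign words can be compared
in `SL(2, ℤ)`. -/
lemma wordMat_bounds (l : List ℤˣ) :
    1 ≤ wordMat l 0 0 ∧ wordMat l 0 1 ≤ 0 ∧ wordMat l 1 0 ≤ 0 ∧ 1 ≤ wordMat l 1 1 := by
  induction l with
  | nil => simp [wordMat_nil]
  | cons e l ih =>
    rcases Int.units_eq_one_or e with rfl | rfl
    · rw [wordMat_cons_one]; simp; omega
    · rw [wordMat_cons_neg_one]; simp; omega

lemma wordMat_offDiag {l : List ℤˣ} (hl : l ≠ []) : wordMat l 0 1 < 0 ∨ wordMat l 1 0 < 0 := by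
  cases l with
  | nil => exact absurd rfl hl
  | cons e l =>
    have := wordMat_bounds l
    rcases Int.units_eq_one_or e with rfl | rfl
    · rw [wordMat_cons_one]; simp; omega
    · rw [wordMat_cons_neg_one]; simp; omega

lemma wordMat_injective : Function.Injective wordMat := by
  intro l
  induction l with
  | nil =>
    intro m h
    by_contra hm
    have := wordMat_offDiag (Ne.symm hm)
    rw [← h, wordMat_nil] at this
    simp at this
  | cons e l ih =>
    intro m h
    cases m with
    | nil =>
      have := wordMat_offDiag (List.cons_ne_nil e l)
      rw [h, wordMat_nil] at this
      simp at this
    | cons f m =>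
      have hl := wordMat_bounds l
      have hm := wordMat_bounds m
      have hij : ∀ i j, wordMat (e :: l) i j = wordMat (f :: m) i j := fun i j => by rw [h]
      have h00 := hij 0 0
      have h01 := hij 0 1
      have h10 := hij 1 0
      have h11 := hij 1 1
      -- The sum of the first column reveals the first sign: it is at most `0` after the sign `1`
      -- and at least `1` after the sign `-1`.
      have hef : e = f := by
        rcases Int.units_eq_one_or e with rfl | rfl <;>
          rcases Int.units_eq_one_or f with rfl | rfl <;>
          first
          | rfl
          | (simp [wordMat_cons_one, wordMat_cons_neg_one] at h00 h01 h10 h11; omega)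
      subst hef
      rw [ih (mul_left_cancel (a := signMat e) (by simpa [wordMat] using h))]

lemma signWord_injective : Function.Injective signWord := by
  intro l m h
  rw [← proj_wordMat, ← proj_wordMat, proj_eq_iff] at h
  rcases h with h | h
  · exact wordMat_injective h
  · have h1 := wordMat_bounds l
    have h2 := wordMat_bounds m
    rw [h] at h1
    simp at h1
    omega

/-- Up to sign, conjugation by `A` keeps the diagonal positive and makes the off-diagonal entries
nonnegative; those of a word matrix are nonpositive, so both vanish. -/
lemma eq_nil_of_A_mul_signWord_mul_A {l m : List ℤˣ} (h : A * signWord l * A = signWord m) :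
    l = [] := by
  by_contra hl
  rw [← proj_wordMat, ← proj_wordMat, A, ← map_mul, ← map_mul, proj_eq_iff] at h
  have h1 := wordMat_bounds l
  have h2 := wordMat_bounds m
  have h3 := wordMat_offDiag hl
  have key : ((matA * wordMat l * matA : Matrix.SpecialLinearGroup (Fin 2) ℤ) :
      Matrix (Fin 2) (Fin 2) ℤ) =
      !![-wordMat l 1 1, wordMat l 1 0; wordMat l 0 1, -wordMat l 0 0] := by
    ext i j
    simp only [Matrix.SpecialLinearGroup.coe_mul, coe_matA]
    fin_cases i <;> fin_cases j <;>
      simp [Matrix.mul_apply, Fin.sum_univ_two, Matrix.vecMul, dotProduct]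
  rcases h with h | h
  all_goals
    rw [h] at key
    have k := fun i j => congrFun (congrFun key i) j
    have k00 := k 0 0
    have k01 := k 0 1
    have k10 := k 1 0
    have k11 := k 1 1
    simp at k00 k01 k10 k11
    omega

lemma closure_A_B : Subgroup.closure {A, B} = (⊤ : Subgroup PSL2Z) := by
  rw [eq_top_iff, ← Subgroup.map_top_of_surjective proj proj_surjective,
    ← SpecialLinearGroup.SL2Z_generators, MonoidHom.map_closure, Subgroup.closure_le]
  have hA : A ∈ Subgroup.closure {A, B} := Subgroup.subset_closure (by simp)
  have hB : B ∈ Subgroup.closure {A, B} := Subgroup.subset_closure (by simp)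
  rintro _ ⟨x, rfl | rfl, rfl⟩
  · exact hA
  · have : proj ModularGroup.T = B * A := by
      rw [A, B, ← map_mul, proj_eq_iff]
      right
      ext i j
      fin_cases i <;> fin_cases j <;> simp [Matrix.SpecialLinearGroup.coe_mul]
    rw [this]
    exact mul_mem hB hA

lemma exists_generator_word (g : PSL2Z) :
    ∃ w : List PSL2Z, (∀ s ∈ w, s = A ∨ s = B ∨ s = B⁻¹) ∧ w.prod = g := by
  have hg : g ∈ Subgroup.closure {A, B} := by rw [closure_A_B]; trivial
  induction hg using Subgroup.closure_induction_left with
  | one => exact ⟨[], by simp, rfl⟩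
  | mul_left x hx y _ ih =>
    obtain ⟨w, hw, rfl⟩ := ih
    refine ⟨x :: w, ?_, by simp⟩
    rcases hx with rfl | rfl <;> simpa using hw
  | inv_mul_cancel x hx y _ ih =>
    obtain ⟨w, hw, rfl⟩ := ih
    refine ⟨x⁻¹ :: w, ?_, by simp⟩
    rcases hx with rfl | rfl
    · simpa [A_inv] using hw
    · simpa using hw

/-! ### Conjugate sign words are cyclic shifts -/

lemma B_zpow_mul_self (e : ℤˣ) : B ^ (e : ℤ) * B ^ (e : ℤ) = B ^ ((-e : ℤˣ) : ℤ) := by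
  rcases Int.units_eq_one_or e with rfl | rfl
  · simpa using B_mul_B
  · simpa using B_inv_mul_B_inv

lemma B_zpow_mul_of_ne {e f : ℤˣ} (h : e ≠ f) : B ^ (e : ℤ) * B ^ (f : ℤ) = 1 := by
  rw [Int.units_ne_iff_eq_neg.mp h]
  simp

lemma signWord_singleton (e : ℤˣ) : signWord [e] = A * B ^ (e : ℤ) := by
  simp [signWord_cons]

/-- Multiplying a nonempty sign word on the right by a power of `B`. -/
lemma signWord_concat_mul_B_zpow (m : List ℤˣ) (e f : ℤˣ) :
    signWord (m ++ [e]) * B ^ (f : ℤ) =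
      if e = f then signWord (m ++ [-e]) else signWord m * A := by
  split_ifs with h
  · subst h
    rw [signWord_append, signWord_append, signWord_singleton, signWord_singleton,
      ← B_zpow_mul_self]
    simp only [mul_assoc]
  · rw [signWord_append, signWord_singleton, mul_assoc, mul_assoc, B_zpow_mul_of_ne h, mul_one]

/-- Either `m` is a prefix of `l'`, which exhibits the rotation, or `m = l' ++ c = c ++ l` and the
shorter list `c` satisfies the same equation. -/
lemma isRotated_of_append_eq_append {α : Type*} {m l l' : List α} (h : m ++ l = l' ++ m) :
    l ~r l' := by
  induction hn : m.length using Nat.strong_induction_on generalizing m with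
  | _ n ih =>
    rcases List.append_eq_append_iff.mp h with ⟨r, rfl, rfl⟩ | ⟨c, rfl, hc⟩
    · exact List.isRotated_append
    · by_cases hl' : l' = []
      · subst hl'
        have : l = [] := by simpa using h
        rw [this]
      · have hlen : c.length < n := by
          have := List.length_pos_iff.mpr hl'
          simp only [List.length_append] at hn
          omega
        exact ih _ hlen hc.symm rfl

/-- This removes a trailing `A` from an intertwiner. The last sign `e` of `m` meets the first sign
`f` of `l`. If they agree, the intertwiner times `signWord l` is itself a sign word; otherwise they
cancel, and the argument repeats with a shorter `m` and `l` rotated by one place. -/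
lemma exists_signWord_intertwiner {m l l' : List ℤˣ} (hl : l ≠ [])
    (h : signWord m * A * signWord l = signWord l' * (signWord m * A)) :
    ∃ m' l₂ : List ℤˣ, l ~r l₂ ∧ signWord m' * signWord l₂ = signWord l' * signWord m' := by
  induction m using List.reverseRecOn generalizing l with
  | nil =>
    exfalso
    apply hl
    apply eq_nil_of_A_mul_signWord_mul_A (m := l')
    simp only [signWord_nil, one_mul] at h
    rw [h, mul_assoc, A_mul_A, mul_one]
  | append_singleton m e ih =>
    cases l with
    | nil => exact absurd rfl hl
    | cons f l =>
      have key : signWord (m ++ [e]) * A * signWord (f :: l) =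
          signWord (m ++ [e]) * B ^ (f : ℤ) * signWord l := by
        rw [signWord_cons]
        simp only [mul_assoc, A_mul_A_mul]
      rw [signWord_concat_mul_B_zpow] at key
      split_ifs at key with hef
      · refine ⟨m ++ [-e] ++ l, f :: l, List.IsRotated.refl _, ?_⟩
        rw [signWord_append, ← key, h, mul_assoc, h]
      · have hrot : f :: l ~r l ++ [f] := (List.isRotated_append (l := [f]) (l' := l))
        have hA : signWord (m ++ [e]) * A * signWord [f] = signWord m * A := by
          have := signWord_concat_mul_B_zpow m e f
          rw [if_neg hef] at this
          rw [← this, signWord_singleton]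
          simp only [mul_assoc, A_mul_A_mul]
        obtain ⟨m', l₂, h1, h2⟩ := ih (l := l ++ [f]) (by simp) (by
          rw [signWord_append, ← mul_assoc, ← key, h, mul_assoc, hA])
        exact ⟨m', l₂, hrot.trans h1, h2⟩

/-- The word of `g` is read letter by letter. Only a power of `B` arriving at an empty sign word
could spoil the form, and an extra copy of `l'` in front prevents this. -/
lemma exists_pow_mul_eq (g : PSL2Z) {l' : List ℤˣ} (hl' : l' ≠ []) :
    ∃ (n : ℕ) (m : List ℤˣ), signWord l' ^ n * g = signWord m ∨
      signWord l' ^ n * g = signWord m * A := by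
  obtain ⟨w, hw, rfl⟩ := exists_generator_word g
  induction w using List.reverseRecOn with
  | nil => exact ⟨0, [], by simp⟩
  | append_singleton w s ih =>
    obtain ⟨n, m, hm⟩ := ih fun s hs => hw s (by simp [hs])
    have hB : ∀ f : ℤˣ, s = B ^ (f : ℤ) → ∃ (n : ℕ) (m : List ℤˣ),
        signWord l' ^ n * (w ++ [s]).prod = signWord m ∨
        signWord l' ^ n * (w ++ [s]).prod = signWord m * A := by
      intro f hf
      rcases hm with hm | hm
      · obtain ⟨m₀, e, he⟩ : ∃ m₀ e, l' ++ m = m₀ ++ [e] := by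
          rcases List.eq_nil_or_concat' (l' ++ m) with h | h
          · simp [hl'] at h
          · exact h
        have : signWord l' ^ (n + 1) * (w ++ [s]).prod =
            signWord (m₀ ++ [e]) * B ^ (f : ℤ) := by
          rw [← he, signWord_append, ← hm, pow_succ', List.prod_append, hf]
          simp [mul_assoc]
        rw [signWord_concat_mul_B_zpow] at this
        split_ifs at this with hef
        · exact ⟨_, _, Or.inl this⟩
        · exact ⟨_, _, Or.inr this⟩
      · refine ⟨n, m ++ [f], Or.inl ?_⟩
        rw [List.prod_append, ← mul_assoc, hm, signWord_append, signWord_singleton, hf]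
        simp [mul_assoc]
    rcases hw s (by simp) with hs | hs | hs
    · rcases hm with hm | hm
      · exact ⟨n, m, Or.inr (by rw [List.prod_append, ← mul_assoc, hm, hs]; simp)⟩
      · exact ⟨n, m, Or.inl (by
          rw [List.prod_append, ← mul_assoc, hm, hs]; simp [mul_assoc, A_mul_A])⟩
    · exact hB 1 (by simpa using hs)
    · exact hB (-1) (by simpa using hs)

/-- Conjugate sign words are cyclic shifts of each other. -/
theorem isRotated_of_isConj_signWord {l l' : List ℤˣ} (hl : l ≠ []) (hl' : l' ≠ [])
    (h : IsConj (signWord l) (signWord l')) : l ~r l' := by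
  obtain ⟨g, hg⟩ := isConj_iff.mp h
  rw [mul_inv_eq_iff_eq_mul] at hg
  -- A conjugator may be multiplied on the left by powers of `signWord l'`, which commute with
  -- `signWord l'`.
  obtain ⟨n, m, hm⟩ := exists_pow_mul_eq g hl'
  have hg' : signWord l' ^ n * g * signWord l = signWord l' * (signWord l' ^ n * g) := by
    rw [mul_assoc, hg, ← mul_assoc, ← mul_assoc, ← pow_succ, pow_succ']
  obtain ⟨m', l₂, hrot, h2⟩ : ∃ m' l₂ : List ℤˣ, l ~r l₂ ∧
      signWord m' * signWord l₂ = signWord l' * signWord m' := by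
    rcases hm with hm | hm
    · exact ⟨m, l, List.IsRotated.refl _, by rw [← hm, hg']⟩
    · exact exists_signWord_intertwiner hl (by rw [← hm, hg'])
  rw [← signWord_append, ← signWord_append] at h2
  exact hrot.trans (isRotated_of_append_eq_append (signWord_injective h2))

lemma isConj_signWord_of_isRotated {l l' : List ℤˣ} (h : l ~r l') :
    IsConj (signWord l) (signWord l') := by
  obtain ⟨n, hn, rfl⟩ := List.isRotated_iff_mod.mp h
  rw [List.rotate_eq_drop_append_take hn, signWord_append, isConj_iff]
  refine ⟨(signWord (l.take n))⁻¹, ?_⟩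
  conv_lhs => rw [← List.take_append_drop n l, signWord_append]
  simp

/-! ### Cyclic reduction and word length -/

lemma abs_trace_eq_of_isConj {X Y : Matrix.SpecialLinearGroup (Fin 2) ℤ}
    (h : IsConj (proj X) (proj Y)) :
    |Matrix.trace (X : Matrix (Fin 2) (Fin 2) ℤ)| =
      |Matrix.trace (Y : Matrix (Fin 2) (Fin 2) ℤ)| := by
  obtain ⟨g, hg⟩ := isConj_iff.mp h
  obtain ⟨Z, rfl⟩ := proj_surjective g
  rw [← map_inv, ← map_mul, ← map_mul, proj_eq_iff] at hg
  have key : Matrix.trace (X : Matrix (Fin 2) (Fin 2) ℤ) =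
      Matrix.trace ((Z * X * Z⁻¹ : Matrix.SpecialLinearGroup (Fin 2) ℤ) :
        Matrix (Fin 2) (Fin 2) ℤ) := by
    rw [Matrix.SpecialLinearGroup.coe_mul, Matrix.trace_mul_comm,
      ← Matrix.SpecialLinearGroup.coe_mul, ← mul_assoc, inv_mul_cancel, one_mul]
  rw [key]
  rcases hg with hg | hg <;> rw [hg]
  simp

lemma two_le_abs_trace_wordMat (l : List ℤˣ) :
    2 ≤ |Matrix.trace (wordMat l : Matrix (Fin 2) (Fin 2) ℤ)| := by
  have := wordMat_bounds l
  rw [Matrix.trace_fin_two]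
  exact le_trans (by omega) (le_abs_self _)

lemma not_isConj_A_signWord (l : List ℤˣ) : ¬ IsConj A (signWord l) := by
  intro h
  rw [← proj_wordMat, A] at h
  have h1 := abs_trace_eq_of_isConj h
  have h2 := two_le_abs_trace_wordMat l
  rw [← h1] at h2
  simp [Matrix.trace_fin_two] at h2

lemma not_isConj_B_zpow_signWord (e : ℤˣ) (l : List ℤˣ) :
    ¬ IsConj (B ^ (e : ℤ)) (signWord l) := by
  intro h
  have h2 := two_le_abs_trace_wordMat l
  rcases Int.units_eq_one_or e with rfl | rfl
  · rw [← proj_wordMat, Units.val_one, zpow_one, B] at h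
    rw [← abs_trace_eq_of_isConj h] at h2
    simp [Matrix.trace_fin_two] at h2
  · rw [← proj_wordMat, Units.val_neg, Units.val_one, zpow_neg, zpow_one, B, ← map_inv] at h
    rw [← abs_trace_eq_of_isConj h] at h2
    simp [Matrix.trace_fin_two] at h2

lemma isConj_mul_comm {G : Type*} [Group G] (a b : G) : IsConj (a * b) (b * a) :=
  isConj_iff.mpr ⟨b, by group⟩

/-- The possible cyclic reductions of an element of length at most `2 * n + 1`. -/
def HasCyclicReduction (n : ℕ) (g : PSL2Z) : Prop :=
  IsConj g A ∨ (∃ e : ℤˣ, IsConj g (B ^ (e : ℤ))) ∨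
    ∃ m : List ℤˣ, m.length ≤ n ∧ IsConj g (signWord m)

lemma HasCyclicReduction.congr {n n' : ℕ} {g g' : PSL2Z} (h : HasCyclicReduction n g)
    (hn : n ≤ n') (hg : IsConj g' g) : HasCyclicReduction n' g' := by
  rcases h with h | ⟨e, h⟩ | ⟨m, hm, h⟩
  · exact Or.inl (hg.trans h)
  · exact Or.inr (Or.inl ⟨e, hg.trans h⟩)
  · exact Or.inr (Or.inr ⟨m, hm.trans hn, hg.trans h⟩)

/-- The two claims feed each other. A final `A`, moved to the front, cancels the first `A` and
leaves a shorter word followed by a power of `B`; a final power of `B` either changes the last sign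
or cancels it, leaving a shorter word followed by `A`. -/
lemma hasCyclicReduction_signWord_mul (m : List ℤˣ) :
    HasCyclicReduction m.length (signWord m * A) ∧
      ∀ e : ℤˣ, HasCyclicReduction m.length (signWord m * B ^ (e : ℤ)) := by
  induction hn : m.length using Nat.strong_induction_on generalizing m with
  | _ n ih =>
    have hB : ∀ e : ℤˣ, HasCyclicReduction n (signWord m * B ^ (e : ℤ)) := by
      intro e
      rcases List.eq_nil_or_concat' m with rfl | ⟨m₀, f, rfl⟩
      · exact Or.inr (Or.inl ⟨e, by rw [signWord_nil, one_mul]⟩)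
      · rw [signWord_concat_mul_B_zpow]
        simp only [List.length_append, List.length_singleton] at hn
        split_ifs
        · exact Or.inr (Or.inr ⟨m₀ ++ [-f], by simp [← hn], IsConj.refl _⟩)
        · exact (ih m₀.length (by omega) m₀ rfl).1.congr (by omega) (IsConj.refl _)
    refine ⟨?_, hB⟩
    cases m with
    | nil => exact Or.inl (by rw [signWord_nil, one_mul])
    | cons e m =>
      have hconj : IsConj (signWord (e :: m) * A) (signWord m * B ^ (e : ℤ)) := by
        have h1 := isConj_mul_comm (signWord (e :: m)) A
        rw [signWord_cons, mul_assoc A, A_mul_A_mul] at h1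
        rw [signWord_cons]
        simp only [mul_assoc] at h1 ⊢
        exact h1.trans (isConj_mul_comm _ _)
      simp only [List.length_cons] at hn
      exact ((ih m.length (by omega) m rfl).2 e).congr (by omega) hconj

/-- A power of `B` in the normal form of an element of the modular group. -/
def optB : Option ℤˣ → PSL2Z
  | none => 1
  | some e => B ^ (e : ℤ)

/-- The length of `optB u`. -/
def optBLength : Option ℤˣ → ℕ
  | none => 0
  | some _ => 1

lemma exists_normalForm (w : List PSL2Z) (hw : ∀ s ∈ w, s = A ∨ s = B ∨ s = B⁻¹) :
    ∃ (u : Option ℤˣ) (m : List ℤˣ),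
      (w.prod = optB u * signWord m ∧ optBLength u + 2 * m.length ≤ w.length) ∨
      (w.prod = optB u * signWord m * A ∧ optBLength u + 2 * m.length + 1 ≤ w.length) := by
  induction w with
  | nil => exact ⟨none, [], Or.inl (by simp [optB, optBLength])⟩
  | cons s w ih =>
    obtain ⟨u, m, h⟩ := ih fun s hs => hw s (by simp [hs])
    have hB : ∀ f : ℤˣ, s = B ^ (f : ℤ) → ∃ u' : Option ℤˣ, s * optB u = optB u' ∧
        optBLength u' ≤ optBLength u + 1 := by
      rintro f rfl
      cases u with
      | none => exact ⟨some f, by simp [optB], by simp [optBLength]⟩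
      | some e =>
        by_cases hef : f = e
        · subst hef
          exact ⟨some (-f), by simp only [optB]; exact B_zpow_mul_self f, by simp [optBLength]⟩
        · exact ⟨none, by simp only [optB]; exact B_zpow_mul_of_ne hef, by simp [optBLength]⟩
    have hB' : (∃ f : ℤˣ, s = B ^ (f : ℤ)) → ∃ (u : Option ℤˣ) (m : List ℤˣ),
        ((s :: w).prod = optB u * signWord m ∧
          optBLength u + 2 * m.length ≤ (s :: w).length) ∨
        ((s :: w).prod = optB u * signWord m * A ∧
          optBLength u + 2 * m.length + 1 ≤ (s :: w).length) := by
      rintro ⟨f, hf⟩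
      obtain ⟨u', h1, h2⟩ := hB f hf
      refine ⟨u', m, h.imp ?_ ?_⟩
      all_goals
        rintro ⟨h3, h4⟩
        rw [List.prod_cons, h3, List.length_cons, ← h1]
        exact ⟨by simp only [mul_assoc], by omega⟩
    rcases hw s (by simp) with rfl | hs | hs
    · cases u with
      | some e =>
        refine ⟨none, e :: m, h.imp ?_ ?_⟩
        all_goals
          rintro ⟨h3, h4⟩
          rw [List.prod_cons, h3, signWord_cons]
          simp only [optB, optBLength, mul_assoc, one_mul, List.length_cons, true_and] at h4 ⊢
          omega
      | none =>
        cases m with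
        | cons e m =>
          refine ⟨some e, m, h.imp ?_ ?_⟩
          all_goals
            rintro ⟨h3, h4⟩
            rw [List.prod_cons, h3, signWord_cons]
            simp only [optB, optBLength, mul_assoc, one_mul, List.length_cons, true_and,
              A_mul_A_mul] at h4 ⊢
            omega
        | nil =>
          -- The product is `1` or `A`, and a further `A` exchanges the two, hence `symm`.
          refine ⟨none, [], h.symm.imp ?_ ?_⟩
          all_goals
            rintro ⟨h3, h4⟩
            rw [List.prod_cons, h3]
            simp [optB, optBLength, A_mul_A]
    · exact hB' ⟨1, by simpa using hs⟩
    · exact hB' ⟨-1, by simpa using hs⟩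

/-- A leading power of `B` can be moved to the end. If an `A` stands there, the two letters make one
more sign, which is why half the length suffices. -/
lemma hasCyclicReduction_of_word (w : List PSL2Z) (hw : ∀ s ∈ w, s = A ∨ s = B ∨ s = B⁻¹) :
    HasCyclicReduction (w.length / 2) w.prod := by
  obtain ⟨u, m, ⟨h1, h2⟩ | ⟨h1, h2⟩⟩ := exists_normalForm w hw <;> rw [h1]
  · cases u with
    | none =>
      simp only [optB, optBLength, one_mul] at h2 ⊢
      exact Or.inr (Or.inr ⟨m, by omega, IsConj.refl _⟩)
    | some e =>
      simp only [optB, optBLength] at h2 ⊢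
      exact ((hasCyclicReduction_signWord_mul m).2 e).congr (by omega) (isConj_mul_comm _ _)
  · cases u with
    | none =>
      simp only [optB, optBLength, one_mul] at h2 ⊢
      exact (hasCyclicReduction_signWord_mul m).1.congr (by omega) (IsConj.refl _)
    | some e =>
      simp only [optB, optBLength] at h2 ⊢
      refine Or.inr (Or.inr ⟨m ++ [e], by simp; omega, ?_⟩)
      rw [signWord_append, signWord_singleton, mul_assoc, ← mul_assoc (signWord m)]
      exact isConj_mul_comm _ _

lemma exists_word_of_signWord (l : List ℤˣ) :
    ∃ w : List PSL2Z, (∀ s ∈ w, s = A ∨ s = B ∨ s = B⁻¹) ∧ w.prod = signWord l ∧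
      w.length = 2 * l.length := by
  induction l with
  | nil => exact ⟨[], by simp⟩
  | cons e l ih =>
    obtain ⟨w, h1, h2, h3⟩ := ih
    refine ⟨A :: B ^ (e : ℤ) :: w, ?_, ?_, ?_⟩
    · intro s hs
      simp only [List.mem_cons] at hs
      rcases hs with rfl | rfl | hs
      · exact Or.inl rfl
      · right
        rcases Int.units_eq_one_or e with rfl | rfl <;> simp
      · exact h1 s hs
    · rw [List.prod_cons, List.prod_cons, h2, signWord_cons, mul_assoc]
    · simp only [List.length_cons, h3]
      ring

/-- The word length of the class of a nonempty sign word is twice the number of signs. -/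
theorem wordLength_mk_signWord {l : List ℤˣ} (hl : l ≠ []) :
    wordLength (ConjClasses.mk (signWord l)) = 2 * l.length := by
  obtain ⟨w₀, hw₀, hp₀, hlen₀⟩ := exists_word_of_signWord l
  apply le_antisymm
  · refine le_trans (Nat.sInf_le ⟨signWord l, rfl, rfl⟩) ?_
    exact Nat.sInf_le ⟨w₀, hw₀, hp₀, hlen₀⟩
  · refine le_csInf ⟨_, signWord l, rfl, rfl⟩ ?_
    rintro _ ⟨g, hg, rfl⟩
    obtain ⟨w₁, hw₁, hp₁⟩ := exists_generator_word g
    refine le_csInf ⟨_, w₁, hw₁, hp₁, rfl⟩ ?_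
    rintro _ ⟨w, hw, rfl, rfl⟩
    have hc : IsConj (signWord l) w.prod := (ConjClasses.mk_eq_mk_iff_isConj.mp hg).symm
    rcases hasCyclicReduction_of_word w hw with h | ⟨e, h⟩ | ⟨m, hm, h⟩
    · exact absurd (hc.trans h).symm (not_isConj_A_signWord l)
    · exact absurd (hc.trans h).symm (not_isConj_B_zpow_signWord e l)
    · have hm0 : m ≠ [] := by
        rintro rfl
        have := hc.trans h
        rw [signWord_nil, isConj_one_left] at this
        exact hl (signWord_injective this)
      have := (isRotated_of_isConj_signWord hl hm0 (hc.trans h)).perm.length_eq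
      omega

/-! ### The axis of a hyperbolic matrix -/

/-- The function whose zero locus is the axis of a hyperbolic matrix. -/
noncomputable def axisForm (h : Matrix.SpecialLinearGroup (Fin 2) ℤ) (z : UpperHalfPlane) : ℝ :=
  h 1 0 * (z.re ^ 2 + z.im ^ 2) + (h 1 1 - h 0 0) * z.re - h 0 1

/-- The displacement depends on `z` only through `axisForm h z / z.im`, so it is least exactly where
the form vanishes, once a zero is known to exist. -/
lemma cosh_dist_smul (h : Matrix.SpecialLinearGroup (Fin 2) ℤ) (z : UpperHalfPlane) :
    Real.cosh (dist z (h • z)) = 1 + ((axisForm h z / z.im) ^ 2 +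
      (((h 0 0 : ℝ) + h 1 1) ^ 2 - 4)) / 2 := by
  have hdet : (h 0 0 : ℝ) * h 1 1 - h 0 1 * h 1 0 = 1 := by
    have := h.det_coe
    rw [Matrix.det_fin_two] at this
    exact_mod_cast this
  have hy := z.im_pos
  have hw := UpperHalfPlane.coe_specialLinearGroup_apply h z
  have hwim : (h • z).im * Complex.normSq ((h 1 0 : ℂ) * z + h 1 1) = z.im := by
    have h1 := ModularGroup.im_smul_eq_div_normSq h z
    rw [ModularGroup.denom_apply] at h1
    rw [h1, div_mul_cancel₀]
    have := UpperHalfPlane.normSq_denom_ne_zero h z.im_ne_zero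
    rwa [ModularGroup.denom_apply] at this
  have hd : (h 1 0 : ℂ) * z + h 1 1 ≠ 0 := by
    intro h0
    rw [h0, map_zero, mul_zero] at hwim
    exact hy.ne hwim
  have hn : Complex.normSq ((h 1 0 : ℂ) * z + h 1 1) ≠ 0 := by simpa using hd
  have hsub : (z : ℂ) - (h • z : UpperHalfPlane) =
      ((h 1 0 : ℂ) * z ^ 2 + (h 1 1 - h 0 0) * z - h 0 1) / ((h 1 0 : ℂ) * z + h 1 1) := by
    rw [hw]
    simp only [algebraMap_int_eq, eq_intCast, Complex.ofReal_intCast]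
    rw [sub_eq_iff_eq_add, ← add_div, eq_div_iff hd]
    ring
  have hN : Complex.normSq ((h 1 0 : ℂ) * z ^ 2 + (h 1 1 - h 0 0) * z - h 0 1) =
      axisForm h z ^ 2 + (((h 0 0 : ℝ) + h 1 1) ^ 2 - 4) * z.im ^ 2 := by
    have : (4 : ℝ) = 4 * (h 0 0 * h 1 1 - h 0 1 * h 1 0) := by rw [hdet, mul_one]
    rw [this, Complex.normSq_apply, axisForm]
    simp [pow_two]
    ring
  rw [UpperHalfPlane.cosh_dist, Complex.dist_eq, ← Complex.normSq_eq_norm_sq, hsub,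
    Complex.normSq_div, hN]
  have him : (h • z).im = z.im / Complex.normSq ((h 1 0 : ℂ) * z + h 1 1) := by
    rw [eq_div_iff hn, hwim]
  rw [him]
  field_simp

lemma isHyperbolic_iff (h : Matrix.SpecialLinearGroup (Fin 2) ℤ) :
    IsHyperbolic h ↔ 2 < |h 0 0 + h 1 1| := by
  rw [IsHyperbolic, Matrix.trace_fin_two]

lemma exists_axisForm_eq_zero {h : Matrix.SpecialLinearGroup (Fin 2) ℤ} (hh : IsHyperbolic h) :
    ∃ z, axisForm h z = 0 := by
  rw [isHyperbolic_iff] at hh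
  have hdet : h 0 0 * h 1 1 - h 0 1 * h 1 0 = 1 := by
    have := h.det_coe
    rwa [Matrix.det_fin_two] at this
  have hr : h 1 0 ≠ 0 := by
    intro h0
    rw [h0, mul_zero, sub_zero] at hdet
    rcases Int.mul_eq_one_iff_eq_one_or_neg_one.mp hdet with ⟨h1, h2⟩ | ⟨h1, h2⟩ <;>
      rw [h1, h2] at hh <;> norm_num at hh
  have hΔ : (4 : ℝ) < ((h 0 0 : ℝ) + h 1 1) ^ 2 := by
    have h1 : (4 : ℤ) < (h 0 0 + h 1 1) ^ 2 := by
      rw [← sq_abs]; nlinarith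
    exact_mod_cast h1
  have hr' : (h 1 0 : ℝ) ≠ 0 := by exact_mod_cast hr
  have hdet' : (h 0 0 : ℝ) * h 1 1 - h 0 1 * h 1 0 = 1 := by exact_mod_cast hdet
  set Δ : ℝ := ((h 0 0 : ℝ) + h 1 1) ^ 2 - 4 with hΔd
  have hΔ0 : 0 < Δ := by linarith
  -- The zero locus is a semicircle centred on the real line; the witness is its highest point.
  refine ⟨⟨⟨(h 0 0 - h 1 1) / (2 * h 1 0), √(Δ / (4 * h 1 0 ^ 2))⟩, by
    show 0 < √(Δ / (4 * (h 1 0 : ℝ) ^ 2)); positivity⟩, ?_⟩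
  have hsq : √(Δ / (4 * (h 1 0 : ℝ) ^ 2)) ^ 2 = Δ / (4 * (h 1 0 : ℝ) ^ 2) :=
    Real.sq_sqrt (by positivity)
  simp only [axisForm, UpperHalfPlane.re, UpperHalfPlane.im]
  rw [hsq]
  field_simp
  rw [hΔd]
  linear_combination (16 : ℝ) * hdet'

lemma mem_axis_iff {h : Matrix.SpecialLinearGroup (Fin 2) ℤ} (hh : IsHyperbolic h)
    (z : UpperHalfPlane) : z ∈ axis h ↔ axisForm h z = 0 := by
  have key : ∀ w : UpperHalfPlane, dist z (h • z) ≤ dist w (h • w) ↔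
      (axisForm h z / z.im) ^ 2 ≤ (axisForm h w / w.im) ^ 2 := by
    intro w
    rw [← abs_of_nonneg (dist_nonneg (x := z) (y := h • z)),
      ← abs_of_nonneg (dist_nonneg (x := w) (y := h • w)), ← Real.cosh_le_cosh, cosh_dist_smul,
      cosh_dist_smul]
    constructor <;> intro h <;> linarith
  simp only [axis, Set.mem_ofPred_eq, key]
  constructor
  · intro hz
    obtain ⟨w, hw⟩ := exists_axisForm_eq_zero hh
    have := hz w
    rw [hw, zero_div, zero_pow two_ne_zero] at this
    have h0 := pow_eq_zero_iff two_ne_zero |>.mp (le_antisymm this (sq_nonneg _))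
    simpa [z.im_pos.ne'] using h0
  · intro hz w
    rw [hz, zero_div, zero_pow two_ne_zero]
    positivity

/-! ### Elements of order two -/

/-- Matrices representing an element of order two have trace zero. -/
lemma trace_eq_zero_of_orderOf_proj {k : Matrix.SpecialLinearGroup (Fin 2) ℤ}
    (hk : orderOf (proj k) = 2) : k 1 1 = -k 0 0 := by
  have h1 : proj k ≠ 1 := by
    intro h
    rw [h, orderOf_one] at hk
    norm_num at hk
  have h2 : proj (k * k) = proj 1 := by
    rw [map_mul, map_one, ← pow_two]; exact orderOf_dvd_iff_pow_eq_one.mp hk.dvd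
  have hdet : k 0 0 * k 1 1 - k 0 1 * k 1 0 = 1 := by
    have := k.det_coe
    rwa [Matrix.det_fin_two] at this
  by_contra hne
  have hs : k 0 0 + k 1 1 ≠ 0 := fun h => hne (by linarith)
  -- The off-diagonal entries of `k * k` are those of `k` times the trace, and `k * k` is plus or
  -- minus the identity.
  have key : k 0 1 * (k 0 0 + k 1 1) = 0 ∧ k 1 0 * (k 0 0 + k 1 1) = 0 := by
    rw [proj_eq_iff] at h2
    have e : ∀ i j, (k * k) i j = k i 0 * k 0 j + k i 1 * k 1 j := by
      intro i j
      simp [Matrix.SpecialLinearGroup.coe_mul, Matrix.mul_apply, Fin.sum_univ_two]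
    have e01 := e 0 1
    have e10 := e 1 0
    rcases h2 with h2 | h2 <;> rw [h2] at e01 e10 <;> simp at e01 e10 <;>
      constructor <;> linarith
  have hb : k 0 1 = 0 := by simpa [hs] using key.1
  have hc : k 1 0 = 0 := by simpa [hs] using key.2
  apply h1
  rw [← map_one proj, proj_eq_iff]
  rw [hb, zero_mul, sub_zero] at hdet
  rcases Int.mul_eq_one_iff_eq_one_or_neg_one.mp hdet with ⟨h3, h4⟩ | ⟨h3, h4⟩
  · left
    ext i j
    fin_cases i <;> fin_cases j <;> simp [h3, h4, hb, hc]
  · right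
    ext i j
    fin_cases i <;> fin_cases j <;> simp [h3, h4, hb, hc]

/-- The points fixed by a matrix of trace zero. -/
lemma smul_eq_self_iff_of_trace_eq_zero {k : Matrix.SpecialLinearGroup (Fin 2) ℤ}
    (hk : k 1 1 = -k 0 0) (z : UpperHalfPlane) : k • z = z ↔
    (k 1 0 : ℝ) * z.re = k 0 0 ∧ (k 1 0 : ℝ) * (z.re ^ 2 + z.im ^ 2) = -k 0 1 := by
  have hd : (k 1 0 : ℂ) * z + k 1 1 ≠ 0 := by
    have := UpperHalfPlane.denom_ne_zero k z
    rwa [ModularGroup.denom_apply] at this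
  have hy := z.im_pos.ne'
  rw [UpperHalfPlane.ext_iff, UpperHalfPlane.coe_specialLinearGroup_apply]
  simp only [algebraMap_int_eq, eq_intCast, Complex.ofReal_intCast]
  rw [div_eq_iff hd, Complex.ext_iff, hk]
  simp
  constructor
  · rintro ⟨h1, h2⟩
    have h3 : (k 1 0 : ℝ) * z.re = k 0 0 := by
      apply mul_right_cancel₀ hy
      linear_combination (-1 / 2 : ℝ) * h2
    refine ⟨h3, ?_⟩
    linear_combination 2 * z.re * h3 + h1
  · rintro ⟨h1, h2⟩
    constructor
    · linear_combination h2 - 2 * z.re * h1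
    · linear_combination -2 * z.im * h1

lemma exists_fixed_of_trace_eq_zero {k : Matrix.SpecialLinearGroup (Fin 2) ℤ}
    (hk : k 1 1 = -k 0 0) : ∃ z : UpperHalfPlane, k • z = z := by
  have hdet : k 0 0 * k 1 1 - k 0 1 * k 1 0 = 1 := by
    have := k.det_coe
    rwa [Matrix.det_fin_two] at this
  rw [hk] at hdet
  have hc : k 1 0 ≠ 0 := by
    intro h
    rw [h, mul_zero] at hdet
    nlinarith [sq_nonneg (k 0 0)]
  have hc' : (k 1 0 : ℝ) ≠ 0 := by exact_mod_cast hc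
  have hdet' : (k 0 0 : ℝ) * -k 0 0 - k 0 1 * k 1 0 = 1 := by exact_mod_cast hdet
  refine ⟨⟨⟨k 0 0 / k 1 0, |(k 1 0 : ℝ)|⁻¹⟩, by
    show 0 < |(k 1 0 : ℝ)|⁻¹; positivity⟩, ?_⟩
  rw [smul_eq_self_iff_of_trace_eq_zero hk]
  simp only [UpperHalfPlane.re, UpperHalfPlane.im]
  refine ⟨by field_simp, ?_⟩
  rw [inv_pow, sq_abs]
  field_simp
  linear_combination -hdet'

/-- Elements of trace zero are conjugate to `A`. -/
lemma isConj_A_of_trace_eq_zero {k : Matrix.SpecialLinearGroup (Fin 2) ℤ}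
    (hk : k 1 1 = -k 0 0) : IsConj A (proj k) := by
  obtain ⟨z, hz⟩ := exists_fixed_of_trace_eq_zero hk
  -- In the fundamental domain the fixed point `x + iy` has `x ^ 2 ≤ 1 / 4` and `y ^ 2 ≥ 3 / 4`.
  -- With lower left entry `c`, the fixed point equations give `c ^ 2 * y ^ 2 = 1`, so `c = ±1`, and
  -- the upper left entry `c * x` is an integer smaller than one in absolute value.
  obtain ⟨g, hg⟩ := ModularGroup.exists_smul_mem_fd z
  set k' := g * k * g⁻¹ with hk'
  have htr : k' 1 1 = -k' 0 0 := by
    have h1 : Matrix.trace (k' : Matrix (Fin 2) (Fin 2) ℤ) =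
        Matrix.trace (k : Matrix (Fin 2) (Fin 2) ℤ) := by
      rw [hk', Matrix.SpecialLinearGroup.coe_mul, Matrix.trace_mul_comm,
        ← Matrix.SpecialLinearGroup.coe_mul, ← mul_assoc, inv_mul_cancel, one_mul]
    rw [Matrix.trace_fin_two, Matrix.trace_fin_two] at h1
    linarith
  have hfix : k' • (g • z) = g • z := by
    rw [hk', smul_smul, inv_mul_cancel_right, mul_smul, hz]
  obtain ⟨h1, h2⟩ := (smul_eq_self_iff_of_trace_eq_zero htr _).mp hfix
  set x := (g • z).re with hx
  set y := (g • z).im with hy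
  have hn : 1 ≤ x ^ 2 + y ^ 2 := by
    have := hg.1
    rw [Complex.normSq_apply] at this
    simp only [UpperHalfPlane.coe_re, UpperHalfPlane.coe_im] at this
    rw [← hx, ← hy] at this
    nlinarith
  have hxx : x ^ 2 ≤ 1 / 4 := by
    have := hg.2
    rw [← hx] at this
    rw [← sq_abs]
    nlinarith [abs_nonneg x]
  have hdet : k' 0 0 * k' 1 1 - k' 0 1 * k' 1 0 = 1 := by
    have := k'.det_coe
    rwa [Matrix.det_fin_two] at this
  rw [htr] at hdet
  have hdet' : (k' 0 0 : ℝ) * -k' 0 0 - k' 0 1 * k' 1 0 = 1 := by exact_mod_cast hdet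
  have hcy : (k' 1 0 : ℝ) ^ 2 * y ^ 2 = 1 := by
    linear_combination (k' 1 0 : ℝ) * h2 + hdet' - ((k' 1 0 : ℝ) * x + k' 0 0) * h1
  have hy2 : 3 / 4 ≤ y ^ 2 := by linarith
  have hc2 : (k' 1 0) ^ 2 < 2 := by
    have : (k' 1 0 : ℝ) ^ 2 < 2 := by nlinarith [sq_nonneg (k' 1 0 : ℝ)]
    exact_mod_cast this
  have ha2 : (k' 0 0) ^ 2 < 1 := by
    have hc2' : (k' 1 0 : ℝ) ^ 2 < 2 := by exact_mod_cast hc2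
    have : (k' 0 0 : ℝ) ^ 2 < 1 := by
      rw [← h1, mul_pow]
      nlinarith [sq_nonneg (k' 1 0 : ℝ), sq_nonneg x]
    exact_mod_cast this
  have ha : k' 0 0 = 0 := by nlinarith
  have hc : k' 1 0 = 1 ∨ k' 1 0 = -1 := by
    have hc0 : k' 1 0 ≠ 0 := by
      intro h
      rw [h] at hdet
      nlinarith
    have : -2 < k' 1 0 := by nlinarith
    have : k' 1 0 < 2 := by nlinarith
    omega
  have hA : proj k' = A := by
    rw [A, proj_eq_iff]
    rcases hc with hc | hc <;> rw [hc, ha] at hdet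
    · left
      have hb : k' 0 1 = -1 := by linarith
      ext i j
      fin_cases i <;> fin_cases j <;> simp [ha, hb, hc, htr]
    · right
      have hb : k' 0 1 = 1 := by linarith
      ext i j
      fin_cases i <;> fin_cases j <;> simp [ha, hb, hc, htr]
  rw [← hA, hk', map_mul, map_mul, map_inv]
  exact (isConj_iff.mpr ⟨proj g, rfl⟩ : IsConj (proj k) _).symm

/-! ### Reciprocal classes as antipalindromic sign words -/

/-- The sign sequence of the inverse: reversed, with all signs changed. -/
def negReverse (l : List ℤˣ) : List ℤˣ := (l.map Neg.neg).reverse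

@[simp] lemma length_negReverse (l : List ℤˣ) : (negReverse l).length = l.length := by
  simp [negReverse]

lemma negReverse_append (l m : List ℤˣ) :
    negReverse (l ++ m) = negReverse m ++ negReverse l := by
  simp [negReverse]

@[simp] lemma negReverse_negReverse (l : List ℤˣ) : negReverse (negReverse l) = l := by
  simp [negReverse, List.map_reverse]

lemma A_mul_signWord_inv_mul_A (l : List ℤˣ) :
    A * (signWord l)⁻¹ * A = signWord (negReverse l) := by
  induction l with
  | nil => simp [negReverse, A_mul_A]
  | cons e l ih =>
    have : negReverse (e :: l) = negReverse l ++ [-e] := by simp [negReverse]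
    rw [this, signWord_append, ← ih, signWord_singleton, signWord_cons]
    simp only [mul_inv_rev, A_inv, mul_assoc, A_mul_A_mul, A_mul_A, mul_one, Units.val_neg,
      zpow_neg]

lemma signWord_append_negReverse (l : List ℤˣ) :
    signWord (l ++ negReverse l) = signWord l * A * (signWord l)⁻¹ * A := by
  rw [signWord_append, ← A_mul_signWord_inv_mul_A]
  simp only [mul_assoc]

/-- In the normal form of `g`, a final `A` commutes with the middle `A` and drops out, and an
initial power of `B` becomes a further sign after conjugation by `A`. -/
lemma exists_isConj_signWord_append_negReverse (g : PSL2Z) :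
    ∃ l : List ℤˣ, IsConj (g * A * g⁻¹ * A) (signWord (l ++ negReverse l)) := by
  obtain ⟨w, hw, rfl⟩ := exists_generator_word g
  obtain ⟨u, m, h⟩ := exists_normalForm w hw
  have key : w.prod * A * w.prod⁻¹ * A =
      optB u * signWord m * A * (optB u * signWord m)⁻¹ * A := by
    rcases h with ⟨h, -⟩ | ⟨h, -⟩ <;> rw [h]
    simp only [mul_inv_rev, A_inv, mul_assoc, A_mul_A_mul]
  rw [key]
  cases u with
  | none =>
    refine ⟨m, ?_⟩
    rw [signWord_append_negReverse]
    simp only [optB, one_mul]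
    exact IsConj.refl _
  | some e =>
    refine ⟨e :: m, isConj_iff.mpr ⟨A, ?_⟩⟩
    rw [signWord_append_negReverse, signWord_cons]
    simp only [optB, mul_inv_rev, A_inv, mul_assoc, A_mul_A, mul_one]

/-- The classes of reciprocal geodesics are the classes of the sign words `l ++ negReverse l`. -/
theorem isReciprocal_iff (c : ConjClasses PSL2Z) :
    IsReciprocal c ↔
      ∃ l : List ℤˣ, l ≠ [] ∧ c = ConjClasses.mk (signWord (l ++ negReverse l)) := by
  constructor
  · rintro ⟨h, hh, rfl, z, hz, k, hk, hkz⟩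
    have hk0 := trace_eq_zero_of_orderOf_proj hk
    obtain ⟨h1, h2⟩ := (smul_eq_self_iff_of_trace_eq_zero hk0 z).mp hkz
    rw [mem_axis_iff hh, axisForm] at hz
    -- The trace of `h * k` is a combination of the axis equation of `h` and the fixed point
    -- equations of `k` at the common point `z`.
    have hm : (h * k) 1 1 = -(h * k) 0 0 := by
      have h3 : (h 1 0 * k 0 1 + h 1 1 * -k 0 0 : ℝ) = -(h 0 0 * k 0 0 + h 0 1 * k 1 0) := by
        linear_combination (-(k 1 0 : ℝ)) * hz + (h 1 0 : ℝ) * h2 +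
          ((h 1 1 : ℝ) - h 0 0) * h1
      have h4 : h 1 0 * k 0 1 + h 1 1 * -k 0 0 = -(h 0 0 * k 0 0 + h 0 1 * k 1 0) := by
        exact_mod_cast h3
      simpa [Matrix.SpecialLinearGroup.coe_mul, Matrix.mul_apply, Fin.sum_univ_two, hk0] using h4
    obtain ⟨g₁, hg₁⟩ := isConj_iff.mp (isConj_A_of_trace_eq_zero hm)
    obtain ⟨g₂, hg₂⟩ := isConj_iff.mp (isConj_A_of_trace_eq_zero hk0)
    obtain ⟨l, hl⟩ := exists_isConj_signWord_append_negReverse (g₂⁻¹ * g₁)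
    have hprod : proj h = g₁ * A * g₁⁻¹ * (g₂ * A * g₂⁻¹) := by
      have h5 : (proj k)⁻¹ = proj k := by rw [← hg₂]; simp [mul_assoc, A_inv]
      have h6 : proj h = proj (h * k) * (proj k)⁻¹ := by rw [map_mul, mul_inv_cancel_right]
      rw [h6, h5, hg₁, hg₂]
    have hc : IsConj (proj h) (signWord (l ++ negReverse l)) := by
      refine IsConj.trans (isConj_iff.mpr ⟨g₂⁻¹, ?_⟩) hl
      rw [hprod]
      simp only [mul_inv_rev, inv_inv, mul_assoc, inv_mul_cancel, mul_one]
    refine ⟨l, ?_, ConjClasses.mk_eq_mk_iff_isConj.mpr hc⟩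
    rintro rfl
    have h1 : IsConj (proj h) (proj 1) := by simpa [negReverse] using hc
    have h7 := abs_trace_eq_of_isConj h1
    rw [IsHyperbolic, h7] at hh
    simp at hh
  · rintro ⟨l, hl, rfl⟩
    have hb := wordMat_bounds l
    have ho := wordMat_offDiag hl
    have hdet : wordMat l 0 0 * wordMat l 1 1 - wordMat l 0 1 * wordMat l 1 0 = 1 := by
      have := (wordMat l).det_coe
      rwa [Matrix.det_fin_two] at this
    have hmat : ((wordMat l * matA * (wordMat l)⁻¹ * matA :
        Matrix.SpecialLinearGroup (Fin 2) ℤ) : Matrix (Fin 2) (Fin 2) ℤ) =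
        !![-(wordMat l 0 0 ^ 2 + wordMat l 0 1 ^ 2),
            -(wordMat l 0 0 * wordMat l 1 0 + wordMat l 0 1 * wordMat l 1 1);
          -(wordMat l 0 0 * wordMat l 1 0 + wordMat l 0 1 * wordMat l 1 1),
            -(wordMat l 1 0 ^ 2 + wordMat l 1 1 ^ 2)] := by
      simp only [Matrix.SpecialLinearGroup.coe_mul, coe_matA,
        Matrix.SpecialLinearGroup.coe_inv, Matrix.adjugate_fin_two]
      ext i j
      fin_cases i <;> fin_cases j <;> simp [Matrix.mul_apply, Fin.sum_univ_two] <;> ring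
    have hh : IsHyperbolic (wordMat l * matA * (wordMat l)⁻¹ * matA) := by
      rw [IsHyperbolic, hmat, Matrix.trace_fin_two]
      refine lt_of_lt_of_le ?_ (neg_le_abs _)
      simp
      rcases ho with ho | ho <;> nlinarith
    -- The matrix is symmetric, so its axis passes through `i`, the fixed point of `A`.
    refine ⟨_, hh, ?_, UpperHalfPlane.I, ?_, matA, ?_, ?_⟩
    · rw [signWord_append_negReverse, ← proj_wordMat, map_mul, map_mul, map_mul, map_inv]
      rfl
    · rw [mem_axis_iff hh, axisForm, hmat]
      simp
    · show orderOf A = 2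
      rw [orderOf_eq_prime_iff]
      refine ⟨by rw [pow_two, A_mul_A], fun h => not_isConj_A_signWord [] (by rw [h]; rfl)⟩
    · rw [smul_eq_self_iff_of_trace_eq_zero (by simp)]
      simp

/-! ### Runs of sign sequences -/

/-- The number of maximal blocks of equal signs of length greater than `D`. -/
def longRuns (D : ℕ) (l : List ℤˣ) : ℕ := (runs l).countP fun r => D < r

@[simp] lemma longRuns_nil (D : ℕ) : longRuns D [] = 0 := by simp [longRuns, runs]

lemma runs_append {l m : List ℤˣ} (h : ∀ x ∈ l.getLast?, ∀ y ∈ m.head?, x ≠ y) :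
    runs (l ++ m) = runs l ++ runs m := by
  rw [runs, List.splitBy_append, List.map_append]
  · rfl
  · intro x hx y hy
    simpa using h x hx y hy

lemma longRuns_append (D : ℕ) {l m : List ℤˣ} (h : l.getLast? ≠ m.head?) :
    longRuns D (l ++ m) = longRuns D l + longRuns D m := by
  rw [longRuns, runs_append, List.countP_append]
  · rfl
  · rintro x hx y hy rfl
    rw [Option.mem_def] at hx hy
    exact h (hx.trans hy.symm)

/-- Both cyclic sequences are cut between distinct signs, so the rotation exchanges two blocks
without breaking or joining a run. -/
lemma longRuns_eq_of_isRotated (D : ℕ) {l l' : List ℤˣ} (h : l ~r l')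
    (hl : l.head? ≠ l.getLast?) (hl' : l'.head? ≠ l'.getLast?) :
    longRuns D l = longRuns D l' := by
  obtain ⟨n, hn, rfl⟩ := List.isRotated_iff_mod.mp h
  rw [List.rotate_eq_drop_append_take hn] at hl' ⊢
  obtain ⟨a, b, rfl, ha, hb⟩ : ∃ a b, l = a ++ b ∧ l.take n = a ∧ l.drop n = b :=
    ⟨_, _, (List.take_append_drop n l).symm, rfl, rfl⟩
  rw [ha, hb] at hl' ⊢
  rcases eq_or_ne a [] with rfl | ha0
  · simp
  rcases eq_or_ne b [] with rfl | hb0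
  · simp
  rw [List.head?_append_of_ne_nil _ ha0, List.getLast?_append_of_ne_nil _ hb0] at hl
  rw [List.head?_append_of_ne_nil _ hb0, List.getLast?_append_of_ne_nil _ ha0] at hl'
  rw [longRuns_append D hl'.symm, longRuns_append D hl.symm, add_comm]

/-- The sign sequence starting with the sign `e` with given run lengths. -/
def expand : ℤˣ → List ℕ → List ℤˣ
  | _, [] => []
  | e, k :: ks => List.replicate k e ++ expand (-e) ks

lemma head?_expand (e : ℤˣ) {k : ℕ} (hk : 0 < k) (ks : List ℕ) :
    (expand e (k :: ks)).head? = some e := by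
  obtain ⟨k, rfl⟩ := Nat.exists_eq_succ_of_ne_zero hk.ne'
  simp [expand, List.replicate_succ]

lemma length_expand (e : ℤˣ) (ks : List ℕ) : (expand e ks).length = ks.sum := by
  induction ks generalizing e with
  | nil => rfl
  | cons k ks ih => simp [expand, ih]

lemma units_int_ne_neg (e : ℤˣ) : e ≠ -e := by
  rcases Int.units_eq_one_or e with rfl | rfl <;> decide

lemma runs_replicate {k : ℕ} (hk : 0 < k) (e : ℤˣ) : runs (List.replicate k e) = [k] := by
  rw [runs, List.splitBy_of_isChain]
  · simp
  · simp [hk.ne']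
  · exact List.Pairwise.isChain (by simp [List.pairwise_replicate])

lemma head?_expand_eq_some {e f : ℤˣ} {ks : List ℕ} (h : ∀ k ∈ ks, 0 < k)
    (hf : (expand e ks).head? = some f) : f = e := by
  cases ks with
  | nil => simp [expand] at hf
  | cons k ks =>
    rw [head?_expand e (h k (by simp)) ks] at hf
    exact (Option.some_injective _ hf).symm

lemma runs_expand (e : ℤˣ) {ks : List ℕ} (h : ∀ k ∈ ks, 0 < k) : runs (expand e ks) = ks := by
  induction ks generalizing e with
  | nil => simp [expand, runs]
  | cons k ks ih =>
    have h' : ∀ k ∈ ks, 0 < k := fun k hk => h k (by simp [hk])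
    rw [expand, runs_append, runs_replicate (h k (by simp)), ih _ h']
    · rfl
    · intro x hx y hy
      have hx' : x = e := List.eq_of_mem_replicate (List.mem_of_getLast? hx)
      rw [hx', head?_expand_eq_some h' hy]
      exact units_int_ne_neg e

lemma getLast?_negReverse (l : List ℤˣ) :
    (negReverse l).getLast? = l.head?.map Neg.neg := by
  simp [negReverse]

lemma head?_negReverse (l : List ℤˣ) :
    (negReverse l).head? = l.getLast?.map Neg.neg := by
  simp [negReverse]

lemma runs_negReverse_expand (e : ℤˣ) {ks : List ℕ} (h : ∀ k ∈ ks, 0 < k) :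
    runs (negReverse (expand e ks)) = ks.reverse := by
  induction ks generalizing e with
  | nil => simp [expand, runs, negReverse]
  | cons k ks ih =>
    have h' : ∀ k ∈ ks, 0 < k := fun k hk => h k (by simp [hk])
    have hrep : negReverse (List.replicate k e) = List.replicate k (-e) := by
      simp [negReverse]
    rw [expand, negReverse_append, hrep, runs_append, runs_replicate (h k (by simp)), ih _ h',
      List.reverse_cons]
    intro x hx y hy
    have hy' : y = -e := List.eq_of_mem_replicate (List.mem_of_head? hy)
    rw [Option.mem_def, getLast?_negReverse, Option.map_eq_some_iff] at hx
    obtain ⟨z, hz, rfl⟩ := hx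
    rw [hy', head?_expand_eq_some h' hz, neg_neg]
    exact units_int_ne_neg e

lemma exists_eq_expand (l : List ℤˣ) :
    ∃ (e : ℤˣ) (ks : List ℕ), (∀ k ∈ ks, 0 < k) ∧ l = expand e ks := by
  induction l with
  | nil => exact ⟨1, [], by simp [expand]⟩
  | cons x l ih =>
    obtain ⟨e, ks, hks, rfl⟩ := ih
    cases ks with
    | nil => exact ⟨x, [1], by simp [expand]⟩
    | cons k ks =>
      by_cases hex : x = e
      · subst hex
        refine ⟨x, (k + 1) :: ks, ?_, ?_⟩
        · intro j hj
          rcases List.mem_cons.mp hj with rfl | hj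
          · omega
          · exact hks j (by simp [hj])
        · simp [expand, List.replicate_succ]
      · refine ⟨x, 1 :: k :: ks, ?_, ?_⟩
        · intro j hj
          rcases List.mem_cons.mp hj with rfl | hj
          · omega
          · exact hks j hj
        · rw [Int.units_ne_iff_eq_neg.mp hex]
          simp [expand]

lemma longRuns_negReverse (D : ℕ) (l : List ℤˣ) :
    longRuns D (negReverse l) = longRuns D l := by
  obtain ⟨e, ks, hks, rfl⟩ := exists_eq_expand l
  rw [longRuns, longRuns, runs_negReverse_expand e hks, runs_expand e hks, List.countP_reverse]

lemma head?_ne_getLast?_append_negReverse {l : List ℤˣ} (hl : l ≠ []) :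
    (l ++ negReverse l).head? ≠ (l ++ negReverse l).getLast? := by
  cases l with
  | nil => exact absurd rfl hl
  | cons x l =>
    have : negReverse (x :: l) ≠ [] := by simp [negReverse]
    rw [List.getLast?_append_of_ne_nil _ this, getLast?_negReverse]
    simp

/-- At the junction the last sign of `l` meets its negative, so no run crosses it. -/
lemma longRuns_append_negReverse (D : ℕ) (l : List ℤˣ) :
    longRuns D (l ++ negReverse l) = 2 * longRuns D l := by
  rcases List.eq_nil_or_concat' l with rfl | ⟨m, x, rfl⟩
  · simp [negReverse]
  · rw [longRuns_append, longRuns_negReverse, two_mul]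
    rw [head?_negReverse]
    simp

/-! ### Rotations between antipalindromes -/

lemma exists_eq_append_negReverse {l : List ℤˣ} (h : negReverse l = l) :
    ∃ a, l = a ++ negReverse a := by
  induction l using List.bidirectionalRec with
  | nil => exact ⟨[], rfl⟩
  | singleton x => exact absurd (by simpa [negReverse] using h.symm) (units_int_ne_neg x)
  | cons_append x l y ih =>
    have h1 : negReverse (x :: (l ++ [y])) = -y :: (negReverse l ++ [-x]) := by
      simp [negReverse]
    rw [h1, List.cons.injEq] at h
    obtain ⟨h2, h3⟩ := h
    obtain ⟨h4, h5⟩ := List.append_inj' h3 rfl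
    obtain ⟨a, ha⟩ := ih h4
    refine ⟨x :: a, ?_⟩
    have h6 : negReverse (x :: a) = negReverse a ++ [-x] := by simp [negReverse]
    rw [h6, ha, List.cons_append, List.append_assoc, h5]

lemma longRuns_ne_one_of_negReverse_eq (D : ℕ) {l : List ℤˣ} (h : negReverse l = l) :
    longRuns D l ≠ 1 := by
  obtain ⟨a, rfl⟩ := exists_eq_append_negReverse h
  rw [longRuns_append_negReverse]
  omega

/-- Commuting lists are powers of a common list. -/
lemma exists_flatten_replicate_of_append_comm {α : Type*} {u v : List α} (h : u ++ v = v ++ u) :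
    ∃ (w : List α) (m n : ℕ), u = (List.replicate m w).flatten ∧
      v = (List.replicate n w).flatten := by
  induction hn : u.length + v.length using Nat.strong_induction_on generalizing u v with
  | _ N ih =>
    rcases eq_or_ne u [] with rfl | hu
    · exact ⟨v, 0, 1, by simp⟩
    rcases eq_or_ne v [] with rfl | hv
    · exact ⟨u, 1, 0, by simp⟩
    have hu' := List.length_pos_iff.mpr hu
    have hv' := List.length_pos_iff.mpr hv
    rcases List.append_eq_append_iff.mp h with ⟨r, hr, hr'⟩ | ⟨r, hr, hr'⟩
    · have h1 : u ++ r = r ++ u := hr.symm.trans hr'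
      obtain ⟨w, m, n, h2, h3⟩ := ih (u.length + r.length)
        (by rw [hr, List.length_append] at hn; omega) h1 rfl
      exact ⟨w, m, m + n, h2, by rw [hr, List.replicate_add, List.flatten_append, ← h2, ← h3]⟩
    · have h1 : v ++ r = r ++ v := hr.symm.trans hr'
      obtain ⟨w, m, n, h2, h3⟩ := ih (v.length + r.length)
        (by rw [hr, List.length_append] at hn; omega) h1 rfl
      exact ⟨w, m + n, m, by rw [hr, List.replicate_add, List.flatten_append, ← h2, ← h3], h2⟩

lemma longRuns_flatten_replicate (D : ℕ) {w : List ℤˣ} (hw : w.head? ≠ w.getLast?) (m : ℕ) :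
    longRuns D (List.replicate m w).flatten = m * longRuns D w := by
  induction m with
  | zero => simp
  | succ m ih =>
    rcases Nat.eq_zero_or_pos m with rfl | hm
    · simp
    · have hw0 : w ≠ [] := by
        rintro rfl
        exact hw rfl
      rw [List.replicate_succ, List.flatten_cons, longRuns_append, ih]
      · ring
      · obtain ⟨m, rfl⟩ := Nat.exists_eq_succ_of_ne_zero hm.ne'
        rw [Nat.succ_eq_add_one, List.replicate_succ, List.flatten_cons,
          List.head?_append_of_ne_nil _ hw0]
        exact hw.symm

lemma head?_getLast?_flatten_replicate {α : Type*} (w : List α) {m : ℕ} (hm : 0 < m) :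
    (List.replicate m w).flatten.head? = w.head? ∧
      (List.replicate m w).flatten.getLast? = w.getLast? := by
  obtain ⟨m, rfl⟩ := Nat.exists_eq_succ_of_ne_zero hm.ne'
  rcases eq_or_ne w [] with rfl | hw
  · simp
  · constructor
    · rw [Nat.succ_eq_add_one, List.replicate_succ, List.flatten_cons,
        List.head?_append_of_ne_nil _ hw]
    · rw [Nat.succ_eq_add_one, List.replicate_succ', List.flatten_append,
        List.flatten_singleton, List.getLast?_append_of_ne_nil _ hw]

/-- Write `x*` for `negReverse x`. The first symmetry gives `b = c ++ a*` with `c* = c`, and the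
second makes `a* ++ a` commute with `c`, so both are powers of one list `w`. If `a` and `c` are
nonempty, `b ++ a` is at least a square of `w`; having two long runs, it is exactly a square, and `c
= w` is an antipalindrome with one long run, which is impossible. -/
lemma eq_nil_or_length_eq_of_negReverse_eq {D : ℕ} {a b : List ℤˣ}
    (h : negReverse (a ++ b) = a ++ b) (h' : negReverse (b ++ a) = b ++ a)
    (hne : (b ++ a).head? ≠ (b ++ a).getLast?)
    (hlong : longRuns D (b ++ a) = 2) (hle : a.length ≤ b.length) :
    a = [] ∨ a.length = b.length := by
  by_contra hcon
  push Not at hcon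
  obtain ⟨ha, hlen⟩ := hcon
  rw [negReverse_append] at h h'
  obtain ⟨c, hc, hc'⟩ : ∃ c, negReverse b = a ++ c ∧ b = c ++ negReverse a := by
    rcases List.append_eq_append_iff.mp h with ⟨c, h1, h2⟩ | ⟨c, h1, h2⟩
    · have hc0 : c = [] := by
        have := congrArg List.length h1
        rw [List.length_append, length_negReverse] at this
        exact List.length_eq_zero_iff.mp (by omega)
      subst hc0
      exact ⟨[], by simpa using h1.symm, by simpa using h2.symm⟩
    · exact ⟨c, h1, h2⟩
  have hcc : negReverse c = c := by
    have : negReverse b = a ++ negReverse c := by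
      conv_lhs => rw [hc', negReverse_append, negReverse_negReverse]
    exact (List.append_cancel_left (hc.symm.trans this)).symm
  have hc0 : c ≠ [] := by
    rintro rfl
    exact hlen (by rw [hc']; simp)
  rw [hc, hc'] at h'
  have hcomm : (negReverse a ++ a) ++ c = c ++ (negReverse a ++ a) := by
    simpa only [List.append_assoc] using h'
  obtain ⟨w, m, n, hm, hn⟩ := exists_flatten_replicate_of_append_comm hcomm
  have hm0 : 0 < m := by
    rcases Nat.eq_zero_or_pos m with rfl | hm0
    · simp [ha] at hm
    · exact hm0
  have hn0 : 0 < n := by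
    rcases Nat.eq_zero_or_pos n with rfl | hn0
    · simp [hc0] at hn
    · exact hn0
  have hba : b ++ a = (List.replicate (n + m) w).flatten := by
    rw [List.replicate_add, List.flatten_append, ← hm, ← hn, hc', List.append_assoc]
  obtain ⟨e1, e2⟩ := head?_getLast?_flatten_replicate w (Nat.add_pos_left hn0 m)
  rw [hba, e1, e2] at hne
  rw [hba, longRuns_flatten_replicate D hne] at hlong
  have hw1 : longRuns D w = 1 ∧ n = 1 := by
    have h2 : 2 ≤ n + m := by omega
    have h3 : longRuns D w ≠ 0 := by
      intro h; rw [h] at hlong; omega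
    have h4 : longRuns D w = 1 := by
      by_contra h5
      have : 2 ≤ longRuns D w := by omega
      nlinarith
    rw [h4] at hlong
    exact ⟨h4, by omega⟩
  rw [hw1.2] at hn
  simp only [List.replicate_one, List.flatten_singleton] at hn
  rw [hn] at hcc
  exact longRuns_ne_one_of_negReverse_eq D hcc hw1.1

lemma negReverse_append_negReverse (l : List ℤˣ) :
    negReverse (l ++ negReverse l) = l ++ negReverse l := by
  rw [negReverse_append, negReverse_negReverse]

/-- By the preceding lemma the rotation is trivial or by half the length, and the half turn
exchanges `l` and `negReverse l`. -/
lemma eq_or_eq_negReverse_of_isRotated {D : ℕ} {l l' : List ℤˣ} (hlen : l.length = l'.length)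
    (hl : longRuns D l = 1) (h : l ++ negReverse l ~r l' ++ negReverse l') :
    l' = l ∨ l' = negReverse l := by
  have hl0 : l ≠ [] := by
    rintro rfl
    simp at hl
  have hl0' : l' ≠ [] := by
    rintro rfl
    exact hl0 (List.length_eq_zero_iff.mp hlen)
  have hne := head?_ne_getLast?_append_negReverse hl0
  have hne' := head?_ne_getLast?_append_negReverse hl0'
  have hlong : longRuns D (l ++ negReverse l) = 2 := by
    rw [longRuns_append_negReverse, hl]
  have hlong' : longRuns D (l' ++ negReverse l') = 2 := by
    rw [← longRuns_eq_of_isRotated D h hne hne', hlong]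
  obtain ⟨n, hn, hrot⟩ := List.isRotated_iff_mod.mp h
  rw [List.rotate_eq_drop_append_take hn] at hrot
  obtain ⟨a, b, hab, ha, hb⟩ : ∃ a b, l ++ negReverse l = a ++ b ∧
      (l ++ negReverse l).take n = a ∧ (l ++ negReverse l).drop n = b :=
    ⟨_, _, (List.take_append_drop n _).symm, rfl, rfl⟩
  rw [ha, hb] at hrot
  have hsym := negReverse_append_negReverse l
  have hsym' := negReverse_append_negReverse l'
  rw [hab] at hsym hne hlong
  rw [← hrot] at hsym' hne' hlong'
  have hcases : a = [] ∨ b = [] ∨ a.length = b.length := by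
    rcases le_total a.length b.length with hle | hle
    · rcases eq_nil_or_length_eq_of_negReverse_eq hsym hsym' hne' hlong' hle with h | h
      · exact Or.inl h
      · exact Or.inr (Or.inr h)
    · rcases eq_nil_or_length_eq_of_negReverse_eq hsym' hsym hne hlong hle with h | h
      · exact Or.inr (Or.inl h)
      · exact Or.inr (Or.inr h.symm)
  rcases hcases with rfl | rfl | hlab
  · left
    rw [List.nil_append] at hab
    rw [List.append_nil, ← hab] at hrot
    exact (List.append_inj_left hrot hlen).symm
  · left
    rw [List.append_nil] at hab
    rw [List.nil_append, ← hab] at hrot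
    exact (List.append_inj_left hrot hlen).symm
  · right
    have h1 := congrArg List.length hab
    have h2 := congrArg List.length hrot
    simp only [List.length_append, length_negReverse] at h1 h2
    have h3 := List.append_inj_right hab (by omega)
    have h4 := List.append_inj_left hrot (by omega)
    rw [← h4, h3]

/-! ### From classes to sign sequences -/

lemma hasExcursions_two_iff (D : ℕ) {l : List ℤˣ} (hl : l ≠ []) :
    HasExcursions D 2 (ConjClasses.mk (signWord (l ++ negReverse l))) ↔ longRuns D l = 1 := by
  have hne := head?_ne_getLast?_append_negReverse hl
  have h2 := longRuns_append_negReverse D l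
  constructor
  · rintro ⟨ε, ⟨h3, h4⟩, h5⟩
    have hε : ε ≠ [] := by
      rintro rfl
      exact h3 rfl
    have hrot := isRotated_of_isConj_signWord hε (by simp [hl])
      (ConjClasses.mk_eq_mk_iff_isConj.mp h4)
    have h6 := longRuns_eq_of_isRotated D hrot h3 hne
    rw [h2, longRuns, h5] at h6
    omega
  · intro h
    exact ⟨_, ⟨hne, rfl⟩, by rw [← longRuns, h2, h]⟩

/-- The reciprocal classes of given length with two excursions, in terms of sign sequences. -/
lemma setOf_excursionSet_eq_image (D t : ℕ) :
    {c ∈ excursionSet D 2 | wordLength c = 4 * t} =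
      (fun l => ConjClasses.mk (signWord (l ++ negReverse l))) ''
        {l : List ℤˣ | l.length = t ∧ longRuns D l = 1} := by
  ext c
  constructor
  · rintro ⟨⟨h1, h2⟩, h3⟩
    obtain ⟨l, hl, rfl⟩ := (isReciprocal_iff c).mp h1
    refine ⟨l, ⟨?_, (hasExcursions_two_iff D hl).mp h2⟩, rfl⟩
    rw [wordLength_mk_signWord (by simp [hl])] at h3
    simp at h3
    omega
  · rintro ⟨l, ⟨h1, h2⟩, rfl⟩
    have hl : l ≠ [] := by
      rintro rfl
      simp at h2
    refine ⟨⟨(isReciprocal_iff _).mpr ⟨l, hl, rfl⟩, (hasExcursions_two_iff D hl).mpr h2⟩, ?_⟩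
    rw [wordLength_mk_signWord (by simp [hl])]
    simp
    omega

lemma finite_signs (D t : ℕ) : {l : List ℤˣ | l.length = t ∧ longRuns D l = 1}.Finite :=
  (List.finite_length_eq ℤˣ t).subset fun _ h => h.1

/-- Each fibre is `{l, negReverse l}`, with two distinct elements because one long run is an odd
number. -/
lemma two_mul_ncard_image_signs (D t : ℕ) :
    2 * {c ∈ excursionSet D 2 | wordLength c = 4 * t}.ncard =
      {l : List ℤˣ | l.length = t ∧ longRuns D l = 1}.ncard := by
  classical
  rw [setOf_excursionSet_eq_image]
  set f : List ℤˣ → ConjClasses PSL2Z :=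
    fun l => ConjClasses.mk (signWord (l ++ negReverse l)) with hf
  set s := (finite_signs D t).toFinset with hs
  have hs' : {l : List ℤˣ | l.length = t ∧ longRuns D l = 1} = s := by simp [hs]
  rw [hs', ← Finset.coe_image, Set.ncard_coe_finset, Set.ncard_coe_finset,
    Finset.card_eq_sum_card_image f s, mul_comm]
  symm
  apply Finset.sum_const_nat
  intro c hc
  obtain ⟨l, hl, rfl⟩ := Finset.mem_image.mp hc
  have hmem : ∀ m, m ∈ s ↔ m.length = t ∧ longRuns D m = 1 := by simp [hs]
  obtain ⟨h1, h2⟩ := (hmem l).mp hl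
  have hl0 : l ≠ [] := by
    rintro rfl
    simp at h2
  rw [Finset.card_eq_two]
  refine ⟨l, negReverse l, fun h => longRuns_ne_one_of_negReverse_eq D h.symm h2, ?_⟩
  ext m
  simp only [Finset.mem_filter, Finset.mem_insert, Finset.mem_singleton, hmem]
  constructor
  · rintro ⟨⟨h3, h4⟩, h5⟩
    have hm0 : m ≠ [] := by
      rintro rfl
      simp at h4
    have hrot := isRotated_of_isConj_signWord (by simp [hl0]) (by simp [hm0])
      (ConjClasses.mk_eq_mk_iff_isConj.mp h5.symm)
    exact eq_or_eq_negReverse_of_isRotated (h1.trans h3.symm) h2 hrot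
  · rintro (rfl | rfl)
    · exact ⟨⟨h1, h2⟩, rfl⟩
    · refine ⟨⟨by simpa using h1, by rw [longRuns_negReverse, h2]⟩, ?_⟩
      rw [hf]
      simp only [negReverse_negReverse]
      exact ConjClasses.mk_eq_mk_iff_isConj.mpr
        (isConj_signWord_of_isRotated List.isRotated_append)

/-! ### Compositions and their generating functions -/

/-- The compositions of `t` with exactly `j` parts greater than `D`. -/
def longCompositions (D j t : ℕ) : Set (List ℕ) :=
  {ks | (∀ k ∈ ks, 0 < k) ∧ ks.sum = t ∧ ks.countP (fun k => D < k) = j}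

lemma finite_longCompositions (D j t : ℕ) : (longCompositions D j t).Finite := by
  refine (Set.finite_range fun c : Composition t => c.blocks).subset ?_
  rintro ks ⟨h1, h2, -⟩
  exact ⟨⟨ks, fun {i} hi => h1 i hi, h2⟩, rfl⟩

lemma ncard_signs (D t : ℕ) :
    {l : List ℤˣ | l.length = t ∧ longRuns D l = 1}.ncard =
      2 * (longCompositions D 1 t).ncard := by
  have himg : {l : List ℤˣ | l.length = t ∧ longRuns D l = 1} =
      (fun p : ℤˣ × List ℕ => expand p.1 p.2) '' (Set.univ ×ˢ longCompositions D 1 t) := by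
    ext l
    constructor
    · rintro ⟨h1, h2⟩
      obtain ⟨e, ks, hks, rfl⟩ := exists_eq_expand l
      rw [length_expand] at h1
      rw [longRuns, runs_expand e hks] at h2
      exact ⟨(e, ks), ⟨trivial, hks, h1, h2⟩, rfl⟩
    · rintro ⟨⟨e, ks⟩, ⟨-, hks, h1, h2⟩, rfl⟩
      refine ⟨by rw [length_expand, h1], ?_⟩
      simp only
      rw [longRuns, runs_expand e hks, h2]
  rw [himg, Set.InjOn.ncard_image, Set.ncard_prod, Set.ncard_univ]
  · simp
  · rintro ⟨e, ks⟩ ⟨-, hks, h1, h2⟩ ⟨e', ks'⟩ ⟨-, hks', h1', h2'⟩ h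
    simp only at h hks h1 h2 hks' h1' h2'
    have h3 : ks = ks' := by rw [← runs_expand e hks, h, runs_expand e' hks']
    subst h3
    cases ks with
    | nil => simp at h2
    | cons k ks =>
      have h4 := congrArg List.head? h
      rw [head?_expand e (hks k (by simp)), head?_expand e' (hks k (by simp))] at h4
      rw [Option.some_injective _ h4]

theorem ncard_excursionSet (D t : ℕ) :
    {c ∈ excursionSet D 2 | wordLength c = 4 * t}.ncard = (longCompositions D 1 t).ncard := by
  have h1 := two_mul_ncard_image_signs D t
  rw [ncard_signs] at h1
  omega

lemma ncard_eq_sum_ncard_cons {S : Set (List ℕ)} (hS : S.Finite) {s : Finset ℕ}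
    (h : ∀ l ∈ S, ∃ k ∈ s, ∃ ks, l = k :: ks) :
    S.ncard = ∑ k ∈ s, {ks | k :: ks ∈ S}.ncard := by
  classical
  have hT : S = hS.toFinset := by simp
  -- The default `0` of `headD` plays no role, since `h` excludes the empty list from `S`.
  rw [Set.ncard_eq_toFinset_card S hS,
    Finset.card_eq_sum_card_fiberwise (f := fun l : List ℕ => l.headD 0) (t := s)]
  · refine Finset.sum_congr rfl fun k _ => ?_
    rw [← Set.ncard_image_of_injective {ks | k :: ks ∈ S} (List.cons_injective (a := k)),
      ← Set.ncard_coe_finset]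
    congr 1
    ext l
    simp only [Finset.coe_filter, Set.Finite.mem_toFinset, Set.mem_ofPred_eq, Set.mem_image]
    constructor
    · rintro ⟨hl, rfl⟩
      obtain ⟨k, -, ks, rfl⟩ := h l hl
      exact ⟨ks, hl, rfl⟩
    · rintro ⟨ks, hks, rfl⟩
      exact ⟨hks, rfl⟩
  · intro l hl
    obtain ⟨k, hk, ks, rfl⟩ := h l (by simpa using hl)
    exact hk

lemma longCompositions_ncard_eq_sum (D j : ℕ) {t : ℕ} (ht : 0 < t) :
    (longCompositions D j t).ncard =
      ∑ k ∈ Finset.Icc 1 t, {ks | k :: ks ∈ longCompositions D j t}.ncard := by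
  refine ncard_eq_sum_ncard_cons (finite_longCompositions D j t) ?_
  rintro l ⟨h1, h2, -⟩
  cases l with
  | nil => simp at h2; omega
  | cons k ks =>
    have := h1 k (by simp)
    simp only [List.sum_cons] at h2
    exact ⟨k, by simp; omega, ks, rfl⟩

lemma setOf_cons_mem_longCompositions_of_le {D j t k : ℕ} (hk : 1 ≤ k) (hkt : k ≤ t)
    (hkD : k ≤ D) : {ks | k :: ks ∈ longCompositions D j t} = longCompositions D j (t - k) := by
  ext ks
  simp only [longCompositions, Set.mem_ofPred_eq, List.mem_cons, forall_eq_or_imp, List.sum_cons,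
    List.countP_cons, decide_eq_true_eq, not_lt.mpr hkD, if_false, add_zero]
  constructor
  · rintro ⟨⟨-, h1⟩, h2, h3⟩
    exact ⟨h1, by omega, h3⟩
  · rintro ⟨h1, h2, h3⟩
    exact ⟨⟨by omega, h1⟩, by omega, h3⟩

lemma setOf_cons_mem_longCompositions_zero {D t k : ℕ} (hkD : D < k) :
    {ks | k :: ks ∈ longCompositions D 0 t} = ∅ := by
  ext ks
  simp [longCompositions, hkD]

lemma setOf_cons_mem_longCompositions_succ {D j t k : ℕ} (hk : 1 ≤ k) (hkt : k ≤ t)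
    (hkD : D < k) :
    {ks | k :: ks ∈ longCompositions D (j + 1) t} = longCompositions D j (t - k) := by
  ext ks
  simp only [longCompositions, Set.mem_ofPred_eq, List.mem_cons, forall_eq_or_imp, List.sum_cons,
    List.countP_cons, decide_eq_true_eq, hkD, if_true, Nat.add_right_cancel_iff]
  constructor
  · rintro ⟨⟨-, h1⟩, h2, h3⟩
    exact ⟨h1, by omega, h3⟩
  · rintro ⟨h1, h2, h3⟩
    exact ⟨⟨by omega, h1⟩, by omega, h3⟩

lemma longCompositions_zero_zero (D : ℕ) : longCompositions D 0 0 = {[]} := by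
  ext ks
  cases ks with
  | nil => simp [longCompositions]
  | cons k ks =>
    simp [longCompositions]
    omega

lemma longCompositions_succ_zero (D j : ℕ) : longCompositions D (j + 1) 0 = ∅ := by
  ext ks
  cases ks with
  | nil => simp [longCompositions]
  | cons k ks =>
    simp [longCompositions]
    omega

/-- The generating function of the compositions with `j` parts greater than `D`. -/
noncomputable def compSeries (D j : ℕ) : PowerSeries ℝ :=
  PowerSeries.mk fun t => ((longCompositions D j t).ncard : ℝ)

/-- The generating function of the parts that are at most `D`. -/
noncomputable def shortSeries (D : ℕ) : PowerSeries ℝ :=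
  PowerSeries.mk fun k => if 1 ≤ k ∧ k ≤ D then 1 else 0

/-- The generating function of the parts that are greater than `D`. -/
noncomputable def longSeries (D : ℕ) : PowerSeries ℝ :=
  PowerSeries.mk fun k => if D < k then 1 else 0

lemma coeff_mul_eq_sum_range (f g : PowerSeries ℝ) (n : ℕ) :
    PowerSeries.coeff n (f * g) =
      ∑ k ∈ Finset.range (n + 1), PowerSeries.coeff k f * PowerSeries.coeff (n - k) g := by
  rw [PowerSeries.coeff_mul, Finset.Nat.sum_antidiagonal_eq_sum_range_succ_mk]

lemma coeff_mul_eq_sum_Icc {f : PowerSeries ℝ} (hf : PowerSeries.coeff 0 f = 0)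
    (g : PowerSeries ℝ) (n : ℕ) :
    PowerSeries.coeff n (f * g) =
      ∑ k ∈ Finset.Icc 1 n, PowerSeries.coeff k f * PowerSeries.coeff (n - k) g := by
  rw [coeff_mul_eq_sum_range]
  symm
  apply Finset.sum_subset
  · intro k hk
    simp at hk ⊢
    omega
  · intro k hk hk'
    have : k = 0 := by
      simp at hk hk'
      omega
    rw [this, hf, zero_mul]

lemma compSeries_zero (D : ℕ) : compSeries D 0 * (1 - shortSeries D) = 1 := by
  have hP : PowerSeries.coeff 0 (shortSeries D) = 0 := by simp [shortSeries]
  rw [mul_sub, mul_one, sub_eq_iff_eq_add, mul_comm]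
  ext t
  rw [map_add, coeff_mul_eq_sum_Icc hP]
  rcases Nat.eq_zero_or_pos t with rfl | ht
  · simp [compSeries, longCompositions_zero_zero]
  · rw [PowerSeries.coeff_one, if_neg ht.ne', zero_add, compSeries, PowerSeries.coeff_mk,
      longCompositions_ncard_eq_sum D 0 ht, Nat.cast_sum]
    refine Finset.sum_congr rfl fun k hk => ?_
    rw [Finset.mem_Icc] at hk
    rw [shortSeries, PowerSeries.coeff_mk, PowerSeries.coeff_mk]
    by_cases hkD : k ≤ D
    · rw [if_pos ⟨hk.1, hkD⟩, setOf_cons_mem_longCompositions_of_le hk.1 hk.2 hkD, one_mul]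
    · rw [if_neg fun h => hkD h.2, setOf_cons_mem_longCompositions_zero (not_le.mp hkD)]
      simp

/-- The first part is either short, with the long part still to come, or it is the long part itself;
solving this linear equation uses that `compSeries D 0` inverts `1 - shortSeries D`. -/
lemma compSeries_one (D : ℕ) :
    compSeries D 1 = longSeries D * (compSeries D 0 * compSeries D 0) := by
  have hP : PowerSeries.coeff 0 (shortSeries D) = 0 := by simp [shortSeries]
  have hQ : PowerSeries.coeff 0 (longSeries D) = 0 := by simp [longSeries]
  have key : compSeries D 1 = shortSeries D * compSeries D 1 + longSeries D * compSeries D 0 := by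
    ext t
    rw [map_add, coeff_mul_eq_sum_Icc hP, coeff_mul_eq_sum_Icc hQ, ← Finset.sum_add_distrib]
    rcases Nat.eq_zero_or_pos t with rfl | ht
    · simp [compSeries, longCompositions_succ_zero D 0]
    · simp only [compSeries, shortSeries, longSeries, PowerSeries.coeff_mk]
      rw [longCompositions_ncard_eq_sum D 1 ht, Nat.cast_sum]
      refine Finset.sum_congr rfl fun k hk => ?_
      rw [Finset.mem_Icc] at hk
      by_cases hkD : k ≤ D
      · rw [if_pos ⟨hk.1, hkD⟩, if_neg (not_lt.mpr hkD),
          setOf_cons_mem_longCompositions_of_le hk.1 hk.2 hkD]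
        simp
      · rw [if_neg fun h => hkD h.2, if_pos (not_le.mp hkD),
          setOf_cons_mem_longCompositions_succ (j := 0) hk.1 hk.2 (not_le.mp hkD)]
        simp
  have h0 := compSeries_zero D
  linear_combination compSeries D 0 * key - compSeries D 1 * h0

/-! ### The positive root -/

section Root

variable {D : ℕ} {α : ℝ}

lemma IsPosRoot.pow_eq (h : IsPosRoot D α) : α ^ D = ∑ i ∈ Finset.range D, α ^ i :=
  sub_eq_zero.mp h.2

lemma IsPosRoot.one_lt (h : IsPosRoot D α) (hD : 2 ≤ D) : 1 < α := by
  by_contra hle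
  have h0 := h.1
  have h1 : α ^ D ≤ 1 := pow_le_one₀ h0.le (not_lt.mp hle)
  have h2 : ∑ i ∈ Finset.range 2, α ^ i ≤ ∑ i ∈ Finset.range D, α ^ i :=
    Finset.sum_le_sum_of_subset_of_nonneg (by simpa using hD) fun _ _ _ => by positivity
  rw [← h.pow_eq] at h2
  simp [Finset.sum_range_succ] at h2
  linarith

lemma IsPosRoot.pow_mul (h : IsPosRoot D α) : α ^ D * (2 - α) = 1 := by
  have := geom_sum_mul α D
  rw [← h.pow_eq] at this
  linarith

lemma IsPosRoot.lt_two (h : IsPosRoot D α) : α < 2 := by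
  have h1 := h.pow_mul
  have h2 : 0 < α ^ D := pow_pos h.1 D
  by_contra hle
  nlinarith

/-- For `i < D` the ratio `x ^ i / x ^ D` is strictly decreasing in `x > 0`, whereas the sum of
these ratios is `1` at every root. -/
lemma IsPosRoot.not_lt {β : ℝ} (hα : IsPosRoot D α) (hβ : IsPosRoot D β) (hD : 2 ≤ D) :
    ¬ α < β := by
  intro hlt
  have h1 := hα.pow_eq
  have h2 := hβ.pow_eq
  have hα0 := hα.1
  have : ∑ i ∈ Finset.range D, β ^ i * α ^ D < ∑ i ∈ Finset.range D, α ^ i * β ^ D := by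
    apply Finset.sum_lt_sum_of_nonempty (by simp; omega)
    intro i hi
    rw [Finset.mem_range] at hi
    obtain ⟨k, rfl⟩ := Nat.exists_eq_add_of_lt hi
    have h3 : α ^ (k + 1) < β ^ (k + 1) := pow_lt_pow_left₀ hlt hα0.le (by omega)
    have h4 : 0 < α ^ i * β ^ i := mul_pos (pow_pos hα0 _) (pow_pos hβ.1 _)
    calc β ^ i * α ^ (i + k + 1) = α ^ i * β ^ i * α ^ (k + 1) := by ring
      _ < α ^ i * β ^ i * β ^ (k + 1) := mul_lt_mul_of_pos_left h3 h4
      _ = α ^ i * β ^ (i + k + 1) := by ring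
  rw [← Finset.sum_mul, ← Finset.sum_mul, ← h1, ← h2, mul_comm] at this
  exact lt_irrefl _ this

lemma existsUnique_isPosRoot (hD : 2 ≤ D) : ∃! α : ℝ, IsPosRoot D α := by
  have hcont : Continuous fun x : ℝ => x ^ D - ∑ i ∈ Finset.range D, x ^ i := by fun_prop
  have h1 : (1 : ℝ) ^ D - ∑ i ∈ Finset.range D, (1 : ℝ) ^ i ≤ 0 := by
    have : (2 : ℝ) ≤ D := by exact_mod_cast hD
    simp
    linarith
  have h2 : 0 ≤ (2 : ℝ) ^ D - ∑ i ∈ Finset.range D, (2 : ℝ) ^ i := by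
    have := geom_sum_mul (2 : ℝ) D
    linarith
  obtain ⟨α, ⟨hα1, -⟩, hα⟩ :=
    intermediate_value_Icc (by norm_num : (1 : ℝ) ≤ 2) hcont.continuousOn ⟨h1, h2⟩
  have hroot : IsPosRoot D α := ⟨by linarith, hα⟩
  refine ⟨α, hroot, fun β hβ => ?_⟩
  exact le_antisymm (not_lt.mp (hroot.not_lt hβ hD)) (not_lt.mp (hβ.not_lt hroot hD))

end Root

/-! ### Limits of recursions and convolutions -/

/-- Each value is bounded by `θ` times a bound for the preceding `m` values, so the bound gains a
factor `θ` every `m + 1` steps. -/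
lemma tendsto_zero_of_contraction {u g : ℕ → ℝ} {m : ℕ} {θ K : ℝ} (hg : ∀ j, 0 ≤ g j)
    (hθ : ∑ j ∈ Finset.range m, g j ≤ θ) (hθ1 : θ < 1) (hK : ∀ n, |u n| ≤ K)
    (hu : ∀ n, m < n → u n = -∑ j ∈ Finset.range m, g j * u (n - (j + 1))) :
    Tendsto u atTop (𝓝 0) := by
  have hθ0 : 0 ≤ θ := (Finset.sum_nonneg fun j _ => hg j).trans hθ
  have hK0 : 0 ≤ K := (abs_nonneg _).trans (hK 0)
  have key : ∀ k n, k * (m + 1) ≤ n → |u n| ≤ K * θ ^ k := by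
    intro k
    induction k with
    | zero => intro n _; simpa using hK n
    | succ k ih =>
      intro n hn
      have hn' : k * (m + 1) + (m + 1) ≤ n := by linarith [add_one_mul k (m + 1)]
      rw [hu n (by omega), abs_neg]
      calc |∑ j ∈ Finset.range m, g j * u (n - (j + 1))|
          ≤ ∑ j ∈ Finset.range m, |g j * u (n - (j + 1))| := Finset.abs_sum_le_sum_abs _ _
        _ ≤ ∑ j ∈ Finset.range m, g j * (K * θ ^ k) := by
            refine Finset.sum_le_sum fun j hj => ?_
            rw [Finset.mem_range] at hj
            rw [abs_mul, abs_of_nonneg (hg j)]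
            exact mul_le_mul_of_nonneg_left (ih _ (by omega)) (hg j)
        _ ≤ θ * (K * θ ^ k) := by
            rw [← Finset.sum_mul]
            exact mul_le_mul_of_nonneg_right hθ (by positivity)
        _ = K * θ ^ (k + 1) := by ring
  have hlim : Tendsto (fun n => K * θ ^ (n / (m + 1))) atTop (𝓝 0) := by
    have h1 := (tendsto_pow_atTop_nhds_zero_of_lt_one hθ0 hθ1).comp
      (Nat.tendsto_div_const_atTop (n := m + 1) (by omega))
    simpa using h1.const_mul K
  exact squeeze_zero_norm (fun n => by
    rw [Real.norm_eq_abs]; exact key _ n (Nat.div_mul_le_self n (m + 1))) hlim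

/-- Since `x k * x (n - k) - d ^ 2` equals `(x k - d) * x (n - k) + d * (x (n - k) - d)`, the error
is at most a constant times the Cesàro mean of `|x k - d|`. -/
lemma tendsto_convolution_self_div {x : ℕ → ℝ} {d : ℝ} (hx : Tendsto x atTop (𝓝 d)) :
    Tendsto (fun n : ℕ => (∑ k ∈ Finset.range (n + 1), x k * x (n - k)) / ((n : ℝ) + 1)) atTop
      (𝓝 (d ^ 2)) := by
  obtain ⟨M, hM⟩ : ∃ M, ∀ n, |x n| ≤ M := by
    obtain ⟨M, hM⟩ := hx.norm.bddAbove_range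
    exact ⟨M, fun n => hM ⟨n, rfl⟩⟩
  have hu : Tendsto (fun n => |x n - d|) atTop (𝓝 0) := by
    have := (hx.sub_const d).abs
    simpa using this
  have hces := (hu.cesaro.comp (tendsto_add_atTop_nat 1)).const_mul (M + |d|)
  rw [mul_zero] at hces
  rw [tendsto_iff_norm_sub_tendsto_zero]
  refine squeeze_zero (fun _ => norm_nonneg _) (fun n => ?_) hces
  have hn : (0 : ℝ) < (n : ℝ) + 1 := by positivity
  have h1 : (∑ k ∈ Finset.range (n + 1), x k * x (n - k)) / ((n : ℝ) + 1) - d ^ 2 =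
      (∑ k ∈ Finset.range (n + 1), ((x k - d) * x (n - k)) +
        ∑ k ∈ Finset.range (n + 1), d * (x (n - k) - d)) / ((n : ℝ) + 1) := by
    rw [← Finset.sum_add_distrib]
    have : ∑ k ∈ Finset.range (n + 1), ((x k - d) * x (n - k) + d * (x (n - k) - d)) =
        ∑ k ∈ Finset.range (n + 1), x k * x (n - k) - ((n : ℝ) + 1) * d ^ 2 := by
      rw [Finset.sum_congr rfl fun k _ =>
        (by ring : (x k - d) * x (n - k) + d * (x (n - k) - d) = x k * x (n - k) - d ^ 2)]
      rw [Finset.sum_sub_distrib]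
      simp
    rw [this]
    field_simp
  rw [h1, Real.norm_eq_abs, abs_div, abs_of_pos hn, div_eq_inv_mul]
  simp only [Function.comp_apply, Nat.cast_add, Nat.cast_one]
  rw [mul_left_comm]
  refine mul_le_mul_of_nonneg_left ?_ (by positivity)
  have hrefl : ∑ k ∈ Finset.range (n + 1), |x (n - k) - d| =
      ∑ k ∈ Finset.range (n + 1), |x k - d| := by
    rw [← Finset.sum_range_reflect (fun k => |x k - d|)]
    simp
  calc |∑ k ∈ Finset.range (n + 1), ((x k - d) * x (n - k)) +
        ∑ k ∈ Finset.range (n + 1), d * (x (n - k) - d)|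
      ≤ ∑ k ∈ Finset.range (n + 1), |(x k - d) * x (n - k)| +
        ∑ k ∈ Finset.range (n + 1), |d * (x (n - k) - d)| :=
          (abs_add_le _ _).trans (add_le_add (Finset.abs_sum_le_sum_abs _ _)
            (Finset.abs_sum_le_sum_abs _ _))
    _ ≤ ∑ k ∈ Finset.range (n + 1), |x k - d| * M +
        ∑ k ∈ Finset.range (n + 1), |d| * |x (n - k) - d| := by
          refine add_le_add (Finset.sum_le_sum fun k _ => ?_) (Finset.sum_le_sum fun k _ => ?_)
          · rw [abs_mul]
            exact mul_le_mul_of_nonneg_left (hM _) (abs_nonneg _)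
          · rw [abs_mul]
    _ = (M + |d|) * ∑ k ∈ Finset.range (n + 1), |x k - d| := by
          rw [← Finset.sum_mul, ← Finset.mul_sum, hrefl]
          ring

/-- The convolution of a summable sequence with a sequence of linear growth. -/
lemma tendsto_convolution_div {q y : ℕ → ℝ} {s c : ℝ} (hq : ∀ i, 0 ≤ q i) (hs : HasSum q s)
    (hy : Tendsto (fun n : ℕ => y n / ((n : ℝ) + 1)) atTop (𝓝 c)) :
    Tendsto (fun t : ℕ => (∑ k ∈ Finset.range (t + 1), q k * y (t - k)) / (t : ℝ)) atTop
      (𝓝 (c * s)) := by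
  obtain ⟨W, hW⟩ : ∃ W, ∀ n : ℕ, |y n / ((n : ℝ) + 1)| ≤ W := by
    obtain ⟨W, hW⟩ := hy.norm.bddAbove_range
    exact ⟨W, fun n => hW ⟨n, rfl⟩⟩
  have hW0 : 0 ≤ W := (abs_nonneg _).trans (hW 0)
  set F : ℕ → ℕ → ℝ := fun t k => if k < t + 1 then q k * y (t - k) / (t : ℝ) else 0 with hF
  have hsum : ∀ t : ℕ, (∑ k ∈ Finset.range (t + 1), q k * y (t - k)) / (t : ℝ) =
      ∑' k, F t k := by
    intro t
    rw [tsum_eq_sum (s := Finset.range (t + 1)), Finset.sum_div]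
    · refine Finset.sum_congr rfl fun k hk => ?_
      rw [hF]
      simp only
      rw [if_pos (Finset.mem_range.mp hk)]
    · intro k hk
      rw [hF]
      simp only
      rw [if_neg fun h => hk (Finset.mem_range.mpr h)]
  simp only [hsum]
  rw [mul_comm, ← hs.tsum_eq, ← tsum_mul_right]
  -- `W` bounds `y n / (n + 1)`, and the factor `2` bounds `(t - k + 1) / t` for `k ≤ t` and `t ≥
  -- 1`.
  refine tendsto_tsum_of_dominated_convergence (bound := fun k => q k * (W * 2))
    (hs.summable.mul_right _) ?_ ?_
  · intro k
    have h1 : Tendsto (fun t : ℕ => q k * (y (t - k) / (((t - k : ℕ) : ℝ) + 1)) *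
        ((((t - k : ℕ) : ℝ) + 1) / (t : ℝ))) atTop (𝓝 (q k * c * 1)) := by
      refine ((hy.comp (tendsto_sub_atTop_nat k)).const_mul (q k)).mul ?_
      have h2 : Tendsto (fun t : ℕ => 1 + (1 - (k : ℝ)) / (t : ℝ)) atTop (𝓝 (1 + 0)) :=
        (tendsto_const_div_atTop_nhds_zero_nat _).const_add 1
      rw [add_zero] at h2
      refine h2.congr' ?_
      filter_upwards [eventually_ge_atTop (k + 1)] with t ht
      have : (0 : ℝ) < t := by exact_mod_cast (by omega : 0 < t)
      rw [Nat.cast_sub (by omega)]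
      field_simp
      ring
    rw [mul_one] at h1
    refine h1.congr' ?_
    filter_upwards [eventually_ge_atTop k] with t ht
    rw [hF]
    simp only
    rw [if_pos (by omega)]
    have : (((t - k : ℕ) : ℝ) + 1) ≠ 0 := by positivity
    field_simp
  · filter_upwards [eventually_ge_atTop 1] with t ht k
    have ht' : (1 : ℝ) ≤ t := by exact_mod_cast ht
    rw [hF]
    simp only
    split_ifs with hk
    · have hpos : (0 : ℝ) < ((t - k : ℕ) : ℝ) + 1 := by positivity
      have h3 : q k * y (t - k) / (t : ℝ) = q k * ((y (t - k) / (((t - k : ℕ) : ℝ) + 1)) *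
          ((((t - k : ℕ) : ℝ) + 1) / (t : ℝ))) := by
        field_simp
      rw [h3, Real.norm_eq_abs, abs_mul, abs_of_nonneg (hq k), abs_mul]
      refine mul_le_mul_of_nonneg_left (mul_le_mul (hW _) ?_ (abs_nonneg _) hW0) (hq k)
      rw [abs_of_nonneg (by positivity), div_le_iff₀ (by linarith)]
      have : ((t - k : ℕ) : ℝ) ≤ t := by exact_mod_cast Nat.sub_le t k
      linarith
    · rw [norm_zero]
      exact mul_nonneg (hq k) (by linarith)

/-! ### The renewal sequence and the asymptotic count -/

section Asymptotics

variable {D : ℕ} {α : ℝ}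

/-- The tails of the probability distribution `k ↦ α⁻¹ ^ k` on `{1, …, D}`. -/
noncomputable def tailCoeff (D : ℕ) (α : ℝ) (j : ℕ) : ℝ :=
  if j < D then (α⁻¹ ^ j - α⁻¹ ^ D) / (α - 1) else 0

lemma IsPosRoot.inv_pow (h : IsPosRoot D α) : α⁻¹ ^ D = 2 - α := by
  have h1 := h.pow_mul
  rw [_root_.inv_pow]
  exact inv_eq_of_mul_eq_one_right h1

lemma tailCoeff_nonneg (h : IsPosRoot D α) (hD : 2 ≤ D) (j : ℕ) : 0 ≤ tailCoeff D α j := by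
  have h1 := h.one_lt hD
  rw [tailCoeff]
  split_ifs with hj
  · have : α⁻¹ ^ D ≤ α⁻¹ ^ j :=
      pow_le_pow_of_le_one (by positivity) (inv_le_one_of_one_le₀ h1.le) hj.le
    exact div_nonneg (by linarith) (by linarith)
  · exact le_rfl

lemma tailCoeff_zero (h : IsPosRoot D α) (hD : 2 ≤ D) : tailCoeff D α 0 = 1 := by
  have h1 := h.one_lt hD
  rw [tailCoeff, if_pos (by omega), h.inv_pow, pow_zero, div_eq_one_iff_eq (by linarith)]
  ring

lemma sum_tailCoeff (h : IsPosRoot D α) (hD : 2 ≤ D) :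
    ∑ j ∈ Finset.range D, tailCoeff D α j = (2 + ((D : ℝ) + 1) * (α - 2)) / (α - 1) := by
  have h1 := h.one_lt hD
  have h0 := h.1
  have hg : ∑ j ∈ Finset.range D, α⁻¹ ^ j = α := by
    have := geom_sum_mul α⁻¹ D
    rw [h.inv_pow] at this
    have h2 : α⁻¹ - 1 ≠ 0 := by
      rw [sub_ne_zero]
      exact (inv_lt_one_of_one_lt₀ h1).ne
    apply mul_right_cancel₀ h2
    rw [this, mul_sub, mul_inv_cancel₀ h0.ne']
    ring
  have hs : ∑ j ∈ Finset.range D, tailCoeff D α j =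
      ∑ j ∈ Finset.range D, (α⁻¹ ^ j - α⁻¹ ^ D) / (α - 1) :=
    Finset.sum_congr rfl fun j hj => if_pos (Finset.mem_range.mp hj)
  rw [hs, ← Finset.sum_div, Finset.sum_sub_distrib, hg, h.inv_pow]
  congr 1
  simp
  ring

/-- The sum of the tails is the mean of the distribution. As the tail at `0` is `1`, the others sum
to less than `1`, which makes the renewal recursion a contraction. -/
lemma sum_tailCoeff_lt_two (h : IsPosRoot D α) (hD : 2 ≤ D) :
    ∑ j ∈ Finset.range D, tailCoeff D α j < 2 := by
  have h1 := h.one_lt hD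
  have h2 := h.lt_two
  have h3 : (2 : ℝ) ≤ D := by exact_mod_cast hD
  rw [sum_tailCoeff h hD, div_lt_iff₀ (by linarith)]
  nlinarith

lemma one_le_sum_tailCoeff (h : IsPosRoot D α) (hD : 2 ≤ D) :
    1 ≤ ∑ j ∈ Finset.range D, tailCoeff D α j := by
  rw [← tailCoeff_zero h hD]
  exact Finset.single_le_sum (fun j _ => tailCoeff_nonneg h hD j) (by simp; omega)

/-- The number of compositions of `n` with all parts at most `D`, divided by `α ^ n`. -/
noncomputable def scaledCount (D : ℕ) (α : ℝ) (n : ℕ) : ℝ :=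
  PowerSeries.coeff n (PowerSeries.rescale α⁻¹ (compSeries D 0))

lemma mk_tailCoeff_mul (h : IsPosRoot D α) (hD : 2 ≤ D) :
    PowerSeries.mk (tailCoeff D α) * (1 - PowerSeries.X) =
      1 - PowerSeries.rescale α⁻¹ (shortSeries D) := by
  have h0 := h.1
  have h1 := h.one_lt hD
  have h2 : α - 1 ≠ 0 := by linarith
  ext n
  cases n with
  | zero =>
    have hz : PowerSeries.coeff 0 (PowerSeries.rescale α⁻¹ (shortSeries D)) = 0 := by
      rw [PowerSeries.coeff_rescale, shortSeries, PowerSeries.coeff_mk]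
      simp
    rw [map_sub, hz]
    simp [mul_sub, tailCoeff_zero h hD]
  | succ n =>
    have hpow : α⁻¹ ^ n = α⁻¹ ^ (n + 1) * α := by
      rw [pow_succ, mul_assoc, inv_mul_cancel₀ h0.ne', mul_one]
    rw [mul_sub, mul_one, map_sub, map_sub, PowerSeries.coeff_succ_mul_X, PowerSeries.coeff_mk,
      PowerSeries.coeff_mk, PowerSeries.coeff_rescale, PowerSeries.coeff_one, shortSeries,
      PowerSeries.coeff_mk, if_neg (Nat.succ_ne_zero n), tailCoeff, tailCoeff]
    rcases lt_trichotomy (n + 1) D with hn | hn | hn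
    · rw [if_pos hn, if_pos (by omega), if_pos ⟨by omega, hn.le⟩, hpow]
      field_simp
      ring
    · rw [if_neg (by omega), if_pos (by omega), if_pos ⟨by omega, hn.le⟩, hpow, hn]
      field_simp
    · rw [if_neg (by omega), if_neg (by omega), if_neg (by omega)]
      simp

lemma scaledCount_nonneg (h : IsPosRoot D α) (n : ℕ) : 0 ≤ scaledCount D α n := by
  have := h.1
  rw [scaledCount, PowerSeries.coeff_rescale, compSeries, PowerSeries.coeff_mk]
  positivity

/-- The factor `1 - X` of the rescaled `1 - shortSeries D` is divided out: the tails times the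
renewal series give `1 / (1 - X)`. -/
lemma sum_tailCoeff_mul_scaledCount (h : IsPosRoot D α) (hD : 2 ≤ D) (n : ℕ) :
    ∑ k ∈ Finset.range (n + 1), tailCoeff D α k * scaledCount D α (n - k) = 1 := by
  set F := PowerSeries.mk (tailCoeff D α) * PowerSeries.rescale α⁻¹ (compSeries D 0) with hF
  have h1 : F * (1 - PowerSeries.X) = 1 := by
    have h2 := congrArg (PowerSeries.rescale α⁻¹) (compSeries_zero D)
    rw [map_mul, map_sub, map_one] at h2
    have h3 := mk_tailCoeff_mul h hD
    rw [hF, mul_right_comm, h3, mul_comm, h2]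
  have h4 : PowerSeries.coeff n F = 1 := by
    induction n with
    | zero => simpa [mul_sub] using congrArg (PowerSeries.coeff 0) h1
    | succ n ih =>
      have h5 := congrArg (PowerSeries.coeff (n + 1)) h1
      rw [mul_sub, mul_one, map_sub, PowerSeries.coeff_succ_mul_X, ih, PowerSeries.coeff_one,
        if_neg (Nat.succ_ne_zero n)] at h5
      linarith
  rw [hF, coeff_mul_eq_sum_range] at h4
  simpa [scaledCount] using h4

lemma scaledCount_le_one (h : IsPosRoot D α) (hD : 2 ≤ D) (n : ℕ) : scaledCount D α n ≤ 1 := by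
  rw [← sum_tailCoeff_mul_scaledCount h hD n]
  have := Finset.single_le_sum
    (f := fun k => tailCoeff D α k * scaledCount D α (n - k)) (s := Finset.range (n + 1))
    (fun k _ => mul_nonneg (tailCoeff_nonneg h hD k) (scaledCount_nonneg h _))
    (Finset.mem_range.mpr (Nat.succ_pos n))
  simpa [tailCoeff_zero h hD] using this

lemma tendsto_scaledCount (h : IsPosRoot D α) (hD : 2 ≤ D) :
    Tendsto (scaledCount D α) atTop (𝓝 (dConst D α)) := by
  set μ := ∑ j ∈ Finset.range D, tailCoeff D α j with hμ
  have hμ1 : 1 ≤ μ := one_le_sum_tailCoeff h hD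
  have hμ2 : μ < 2 := sum_tailCoeff_lt_two h hD
  have hd : dConst D α = μ⁻¹ := by rw [hμ, sum_tailCoeff h hD, inv_div, dConst]
  obtain ⟨m, rfl⟩ : ∃ m, D = m + 1 := ⟨D - 1, by omega⟩
  have hμs : ∑ j ∈ Finset.range m, tailCoeff (m + 1) α (j + 1) = μ - 1 := by
    rw [hμ, Finset.sum_range_succ', tailCoeff_zero h hD]
    ring
  -- Subtracting the constant solution `μ⁻¹` makes the recursion homogeneous, with coefficients the
  -- tails at `j ≥ 1`, of sum `μ - 1 < 1`.
  have hu : Tendsto (fun n => scaledCount (m + 1) α n - μ⁻¹) atTop (𝓝 0) := by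
    refine tendsto_zero_of_contraction (g := fun j => tailCoeff (m + 1) α (j + 1)) (m := m)
      (θ := μ - 1) (K := 1 + μ⁻¹) (fun j => tailCoeff_nonneg h hD _) hμs.le (by linarith) ?_ ?_
    · intro n
      have h1 := scaledCount_nonneg h n
      have h2 := scaledCount_le_one h hD n
      have h3 : 0 ≤ μ⁻¹ := by positivity
      rw [abs_le]
      constructor <;> linarith
    · intro n hn
      have h1 := sum_tailCoeff_mul_scaledCount h hD n
      have h2 : ∑ k ∈ Finset.range (m + 1),
          tailCoeff (m + 1) α k * scaledCount (m + 1) α (n - k) = 1 := by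
        rw [← h1]
        apply Finset.sum_subset
        · intro k hk
          simp at hk ⊢
          omega
        · intro k _ hk
          rw [Finset.mem_range] at hk
          rw [tailCoeff, if_neg hk, zero_mul]
      rw [Finset.sum_range_succ', tailCoeff_zero h hD, one_mul, Nat.sub_zero] at h2
      simp only [mul_sub, Finset.sum_sub_distrib, ← Finset.sum_mul, hμs, sub_mul, one_mul]
      rw [mul_inv_cancel₀ (by linarith)]
      linarith
  rw [hd]
  simpa using hu.add_const μ⁻¹

lemma hasSum_rescale_longSeries (h : IsPosRoot D α) (hD : 2 ≤ D) :
    HasSum (fun k => PowerSeries.coeff k (PowerSeries.rescale α⁻¹ (longSeries D)))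
      (1 / (α ^ D * (α - 1))) := by
  have h0 := h.1
  have h1 := h.one_lt hD
  have h2 : α - 1 ≠ 0 := by linarith
  rw [← hasSum_nat_add_iff' (D + 1)]
  have hz : ∑ k ∈ Finset.range (D + 1),
      PowerSeries.coeff k (PowerSeries.rescale α⁻¹ (longSeries D)) = 0 := by
    refine Finset.sum_eq_zero fun k hk => ?_
    rw [Finset.mem_range] at hk
    rw [PowerSeries.coeff_rescale, longSeries, PowerSeries.coeff_mk, if_neg (by omega), mul_zero]
  rw [hz, sub_zero]
  have hgeo := (hasSum_geometric_of_lt_one (inv_nonneg.mpr h0.le)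
    (inv_lt_one_of_one_lt₀ h1)).mul_left (α⁻¹ ^ (D + 1))
  have hval : α⁻¹ ^ (D + 1) * (1 - α⁻¹)⁻¹ = 1 / (α ^ D * (α - 1)) := by
    have : 1 - α⁻¹ = (α - 1) / α := by field_simp
    rw [this, inv_div, pow_succ, _root_.inv_pow]
    field_simp
  rw [hval] at hgeo
  refine hgeo.congr_fun ?_
  intro k
  rw [PowerSeries.coeff_rescale, longSeries, PowerSeries.coeff_mk, if_pos (by omega), mul_one,
    pow_add, mul_comm]

lemma tendsto_ncard_longCompositions (h : IsPosRoot D α) (hD : 2 ≤ D) :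
    Tendsto (fun t : ℕ => ((longCompositions D 1 t).ncard : ℝ) / ((t : ℝ) * α ^ t)) atTop
      (𝓝 (dConst D α ^ 2 / (α ^ D * (α - 1)))) := by
  have h0 := h.1
  have h1 := tendsto_convolution_div
    (q := fun k => PowerSeries.coeff k (PowerSeries.rescale α⁻¹ (longSeries D)))
    (fun k => by
      rw [PowerSeries.coeff_rescale, longSeries, PowerSeries.coeff_mk]
      split_ifs <;> positivity)
    (hasSum_rescale_longSeries h hD) (tendsto_convolution_self_div (tendsto_scaledCount h hD))
  rw [mul_one_div] at h1
  refine h1.congr fun t => ?_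
  have h2 := congrArg (PowerSeries.coeff t)
    (congrArg (PowerSeries.rescale α⁻¹) (compSeries_one D))
  rw [map_mul (PowerSeries.rescale α⁻¹), map_mul (PowerSeries.rescale α⁻¹),
    coeff_mul_eq_sum_range, PowerSeries.coeff_rescale, compSeries,
    PowerSeries.coeff_mk] at h2
  simp only [coeff_mul_eq_sum_range] at h2
  have h3 : ((longCompositions D 1 t).ncard : ℝ) / ((t : ℝ) * α ^ t) =
      (α⁻¹ ^ t * (longCompositions D 1 t).ncard) / (t : ℝ) := by
    rw [_root_.inv_pow, mul_comm (t : ℝ), ← div_div, div_eq_inv_mul _ (α ^ t)]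
  rw [h3, h2]
  rfl

end Asymptotics

end ReciprocalGeodesics

theorem theorem3p2 (D : ℕ) (hD : 2 ≤ D) :
    (∃! α : ℝ, ReciprocalGeodesics.IsPosRoot D α) ∧
    (∀ t : ℕ, {c ∈ ReciprocalGeodesics.excursionSet D 2 |
      ReciprocalGeodesics.wordLength c = 4 * t}.Finite) ∧
    ∀ α : ℝ, ReciprocalGeodesics.IsPosRoot D α →
      Tendsto
        (fun t : ℕ =>
          (({c ∈ ReciprocalGeodesics.excursionSet D 2 |
              ReciprocalGeodesics.wordLength c = 4 * t}.ncard : ℕ) : ℝ) / ((t : ℝ) * α ^ t))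
        atTop
        (𝓝 (ReciprocalGeodesics.dConst D α ^ 2 / (α ^ D * (α - 1)))) := by
  refine ⟨ReciprocalGeodesics.existsUnique_isPosRoot hD, fun t => ?_, fun α hα => ?_⟩
  · rw [ReciprocalGeodesics.setOf_excursionSet_eq_image]
    exact (ReciprocalGeodesics.finite_signs D t).image _
  · simp only [ReciprocalGeodesics.ncard_excursionSet]
    exact ReciprocalGeodesics.tendsto_ncard_longCompositions hα hD
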